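/- Let $(X,\mathfrak A,\mu)$ be a probability space and let $T:X\to X$ be an ergodic measure-preserving map that is invertible, in the sense that it has a measurable inverse $\mu$-almost everywhere. Let $\mathcal K\subseteq L^2(X,\mu)$ be the Kronecker factor of $T$, that is, the closed linear span in the complex Hilbert space $L^2(X,\mu)$ of the eigenfunctions of the Koopman operator $h\mapsto h\circ T$. Let $f:X\to\mathbb C$ be a function in $\mathcal K^\perp\cap L^\infty(X,\mu)$ that takes only finitely many values. Then there exists a set $X'\in\mathfrak A$ with $\mu(X')=1$, depending only on $(X,\mathfrak A,\mu,T)$ and $f$, with the following property: for every probability space $(Y,\mathfrak B,\nu)$, every ergodic measure-preserving map $S:Y\to Y$ that is invertible in the same sense, every $g\in L^\infty(Y,\nu)$ (complex-valued), and every $x\in X'$, $$\lim_{N\to\infty}\frac1N\sum_{n=1}^N f(T^nx)\,g(S^ny)=0\qquad\text{for }\nu\text{-almost every }y\in Y.$$ -/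

import Mathlib

open MeasureTheory Filter
open scoped Topology ENNReal

/-- A map `T` of a measure space is invertible (modulo null sets) if it has a measurable
almost-everywhere two-sided inverse. In particular every bijective bimeasurable map is. -/
def IsAEInvertible {X : Type*} [MeasurableSpace X] (T : X → X) (μ : Measure X) : Prop :=
  ∃ T' : X → X, Measurable T' ∧ (∀ᵐ x ∂μ, T' (T x) = x) ∧ (∀ᵐ x ∂μ, T (T' x) = x)

/-- The Koopman operator `h ↦ h ∘ T` on `L²(X, μ)` of a measure preserving map `T`. -/
noncomputable def koopman {X : Type*} [MeasurableSpace X] {μ : Measure X} {T : X → X}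
    (hT : MeasurePreserving T μ μ) : Lp ℂ 2 μ →ₗᵢ[ℂ] Lp ℂ 2 μ :=
  Lp.compMeasurePreservingₗᵢ ℂ T hT

/-- The Kronecker factor: the closed linear span in `L²(X, μ)` of the eigenfunctions of `T`. -/
noncomputable def kroneckerFactor {X : Type*} [MeasurableSpace X] {μ : Measure X} {T : X → X}
    (hT : MeasurePreserving T μ μ) : Submodule ℂ (Lp ℂ 2 μ) :=
  (Submodule.span ℂ {h : Lp ℂ 2 μ |
    ∃ c : ℂ, Module.End.HasEigenvector (koopman hT).toLinearMap c h}).topologicalClosure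

/-! ### Maximal inequality and a one-sided pointwise ergodic theorem. -/

section MaximalErgodic

variable {X : Type*}

/-! The argument follows Bourgain, Furstenberg, Katznelson and Ornstein. It reduces the theorem to a
property of the single sequence c n = f (T^n x), and then shows that any bounded sequence with this
property is good for every system Y.

For a T × T-invariant set E ⊆ X × X, the integral operator A with kernel 1_E is compact and commutes
with the unitary Koopman operator. The eigenspaces of A*A for nonzero eigenvalues are
finite-dimensional and invariant, hence spanned by eigenfunctions of T, so A kills f ∈ K^⊥. Thus
conj f ⊗ f has integral zero over E (`setIntegral_invariant_eq_zero`). By the pointwise ergodic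
theorem on X × X, for almost every x the orbit of almost every ξ is asymptotically uncorrelated with
that of x. Ergodicity of T turns this into `HasSmallCorrelations`: initial words of c with length in
[M, R] correlate with few translates inside c, where M is chosen before R
(`ae_hasSmallCorrelations`).

Suppose that, on a set of positive measure in Y, the averages of c against the orbit of a bounded g
exceed ε infinitely often (`ae_eventually_re_sum_lt`). For K widely separated scales, some orbit
segment of length N then has a positive proportion of starting points at which, at every scale, some
initial word of c correlates with g. Copies of such words laid in disjoint blocks give one vector
per scale, of norm O(√N), whose pairing with g is at least a constant times N. Small correlations
make the K vectors nearly orthogonal (`exists_superposition`), so their sum has norm O(√(KN)) but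
pairing of order KN. Cauchy–Schwarz bounds K (`card_bound_of_scales`), a contradiction. -/

/-- The maximal function `max_{0 ≤ n ≤ N} ∑_{k < n} F (S^k x)`, defined recursively. -/
noncomputable def birkhoffMax (S : X → X) (F : X → ℝ) : ℕ → X → ℝ
  | 0 => fun _ => 0
  | N + 1 => fun x => max 0 (F x + birkhoffMax S F N (S x))

theorem birkhoffMax_nonneg (S : X → X) (F : X → ℝ) (N : ℕ) (x : X) : 0 ≤ birkhoffMax S F N x := by
  cases N with
  | zero => exact le_rfl
  | succ N => exact le_max_left _ _

theorem birkhoffMax_le_succ (S : X → X) (F : X → ℝ) (N : ℕ) (x : X) :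
    birkhoffMax S F N x ≤ birkhoffMax S F (N + 1) x := by
  induction N generalizing x with
  | zero => exact birkhoffMax_nonneg S F 1 x
  | succ N ih => exact max_le_max le_rfl (by gcongr; exact ih _)

theorem monotone_birkhoffMax (S : X → X) (F : X → ℝ) (x : X) :
    Monotone fun N => birkhoffMax S F N x :=
  monotone_nat_of_le_succ fun N => birkhoffMax_le_succ S F N x

theorem birkhoffSum_le_birkhoffMax (S : X → X) (F : X → ℝ) (N : ℕ) (x : X) :
    birkhoffSum S F N x ≤ birkhoffMax S F N x := by
  induction N generalizing x with
  | zero => simp [birkhoffMax]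
  | succ N ih =>
    rw [birkhoffSum_succ']
    exact le_max_of_le_right (by gcongr; exact ih _)

/-- This is the pointwise inequality of Garsia's proof of the maximal theorem. A positive maximum is
not attained by the empty sum, so the recursion gives it exactly, and monotonicity raises the index
on the right back to N. -/
theorem birkhoffMax_sub_le (S : X → X) (F : X → ℝ) (N : ℕ) (x : X) (h : 0 < birkhoffMax S F N x) :
    birkhoffMax S F N x - birkhoffMax S F N (S x) ≤ F x := by
  cases N with
  | zero => exact absurd h (lt_irrefl _)
  | succ N =>
    have h1 : birkhoffMax S F (N + 1) x = F x + birkhoffMax S F N (S x) := by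
      rcases max_choice 0 (F x + birkhoffMax S F N (S x)) with h2 | h2
      · exact absurd (h.trans_eq h2) (lt_irrefl _)
      · exact h2
    linarith [birkhoffMax_le_succ S F N (S x)]

theorem birkhoffMax_le {S : X → X} {F : X → ℝ} {C : ℝ} (hC : ∀ x, |F x| ≤ C) (N : ℕ) (x : X) :
    birkhoffMax S F N x ≤ N * C := by
  have hC0 : 0 ≤ C := (abs_nonneg _).trans (hC x)
  induction N generalizing x with
  | zero => simp [birkhoffMax]
  | succ N ih =>
    refine max_le (by positivity) ?_
    push_cast
    linarith [ih (S x), le_abs_self (F x), hC x]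

variable [MeasurableSpace X]

theorem measurable_birkhoffMax {S : X → X} {F : X → ℝ} (hS : Measurable S) (hF : Measurable F)
    (N : ℕ) : Measurable (birkhoffMax S F N) := by
  induction N with
  | zero => exact measurable_const
  | succ N ih => exact measurable_const.max (hF.add (ih.comp hS))

theorem measurable_birkhoffSum {M : Type*} [AddCommMonoid M] [MeasurableSpace M] [MeasurableAdd₂ M]
    {S : X → X} {F : X → M} (hS : Measurable S) (hF : Measurable F) (N : ℕ) :
    Measurable (birkhoffSum S F N) :=
  Finset.measurable_fun_sum _ fun k _ => hF.comp (hS.iterate k)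

variable {μ : Measure X}

theorem integrable_of_forall_abs_le [IsFiniteMeasure μ] {F : X → ℝ} (hF : Measurable F) {C : ℝ}
    (hC : ∀ x, |F x| ≤ C) : Integrable F μ :=
  Integrable.of_bound hF.aestronglyMeasurable C (ae_of_all _ hC)

/-- The maximal ergodic theorem for bounded functions. -/
theorem setIntegral_birkhoffMax_pos_nonneg [IsFiniteMeasure μ] {S : X → X}
    (hS : MeasurePreserving S μ μ) {F : X → ℝ} (hF : Measurable F) {C : ℝ} (hC : ∀ x, |F x| ≤ C)
    (N : ℕ) : 0 ≤ ∫ x in {x | 0 < birkhoffMax S F N x}, F x ∂μ := by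
  set M := birkhoffMax S F N
  have hM : Measurable M := measurable_birkhoffMax hS.measurable hF N
  have hMi : Integrable M μ := integrable_of_forall_abs_le hM (C := N * C) fun x => by
    rw [abs_of_nonneg (birkhoffMax_nonneg S F N x)]
    exact birkhoffMax_le hC N x
  have hMSi : Integrable (fun x => M (S x)) μ := (hS.integrable_comp hM.aestronglyMeasurable).2 hMi
  have hA : MeasurableSet {x | 0 < M x} := measurableSet_lt measurable_const hM
  have h1 : ∫ x in {x | 0 < M x}, (M x - M (S x)) ∂μ ≤ ∫ x in {x | 0 < M x}, F x ∂μ :=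
    setIntegral_mono_on (hMi.sub hMSi).integrableOn
      (integrable_of_forall_abs_le hF hC).integrableOn hA fun x hx => birkhoffMax_sub_le S F N x hx
  -- Where M is not positive it is zero, so M - M ∘ S ≤ 0 there and dropping that part only
  -- increases the integral.
  have h2 : ∫ x, (M x - M (S x)) ∂μ ≤ ∫ x in {x | 0 < M x}, (M x - M (S x)) ∂μ := by
    rw [← integral_indicator hA]
    refine integral_mono (hMi.sub hMSi) ((hMi.sub hMSi).indicator hA) fun x => ?_
    by_cases hx : 0 < M x
    · rw [Set.indicator_of_mem (show x ∈ {x | 0 < M x} from hx)]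
    · rw [Set.indicator_of_notMem (show x ∉ {x | 0 < M x} from hx)]
      linarith [birkhoffMax_nonneg S F N (S x)]
  have h3 : ∫ x, (M x - M (S x)) ∂μ = 0 := by
    have h4 : ∫ x, M (S x) ∂μ = ∫ x, M x ∂μ := by
      have h5 := integral_map hS.measurable.aemeasurable (f := M)
        (hM.aestronglyMeasurable (μ := μ.map S))
      rw [hS.map_eq] at h5
      exact h5.symm
    rw [integral_sub hMi hMSi, h4, sub_self]
  linarith

/-- The measure restricted to E is still preserved, so the maximal theorem applies on E; the sets
where `birkhoffMax` is positive increase with N and exhaust E. -/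
theorem setIntegral_nonneg_of_forall_exists_birkhoffSum_pos [IsFiniteMeasure μ] {S : X → X}
    (hS : MeasurePreserving S μ μ) {F : X → ℝ} (hF : Measurable F) {C : ℝ} (hC : ∀ x, |F x| ≤ C)
    {E : Set X} (hE : MeasurableSet E) (hSE : S ⁻¹' E = E)
    (h : ∀ x ∈ E, ∃ n, 0 < birkhoffSum S F n x) : 0 ≤ ∫ x in E, F x ∂μ := by
  have hS' : MeasurePreserving S (μ.restrict E) (μ.restrict E) := by
    simpa [hSE] using hS.restrict_preimage hE
  let A : ℕ → Set X := fun N => {x | 0 < birkhoffMax S F N x}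
  have hA : ∀ N, MeasurableSet (A N) := fun N =>
    measurableSet_lt measurable_const (measurable_birkhoffMax hS.measurable hF N)
  have hmono : Monotone A := fun a b hab x hx =>
    lt_of_lt_of_le hx (monotone_birkhoffMax S F x hab)
  have hlim := tendsto_setIntegral_of_monotone (μ := μ.restrict E) (f := F) hA hmono
    (integrable_of_forall_abs_le hF hC).integrableOn
  have hun : ∫ x in ⋃ N, A N, F x ∂(μ.restrict E) = ∫ x in E, F x ∂μ := by
    rw [Measure.restrict_restrict (MeasurableSet.iUnion hA), Set.inter_eq_right.2]
    intro x hx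
    obtain ⟨n, hn⟩ := h x hx
    exact Set.mem_iUnion.2 ⟨n, hn.trans_le (birkhoffSum_le_birkhoffMax S F n x)⟩
  rw [hun] at hlim
  exact ge_of_tendsto' hlim fun N => setIntegral_birkhoffMax_pos_nonneg hS' hF hC N

/-- A one-sided pointwise ergodic theorem: if a bounded function has nonpositive integral over
each invariant set, then the upper limit of its ergodic averages is almost everywhere
nonpositive. -/
theorem ae_eventually_birkhoffSum_lt [IsFiniteMeasure μ] {S : X → X}
    (hS : MeasurePreserving S μ μ) {F : X → ℝ} (hF : Measurable F) {C : ℝ} (hC : ∀ x, |F x| ≤ C)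
    (hinv : ∀ E, MeasurableSet E → S ⁻¹' E = E → ∫ x in E, F x ∂μ ≤ 0) {ε : ℝ} (hε : 0 < ε) :
    ∀ᵐ x ∂μ, ∀ᶠ n : ℕ in atTop, birkhoffSum S F n x < ε * n := by
  -- The additive slack D makes E exactly invariant: passing from x to S x changes the inequality by
  -- at most C + ε.
  let E : Set X := {x | ∃ D : ℕ, ∃ᶠ n : ℕ in atTop, ε * n - D ≤ birkhoffSum S F n x}
  have hE : MeasurableSet E := by
    have h1 : E = ⋃ D : ℕ, ⋂ a : ℕ, ⋃ n : ℕ, {x | a ≤ n ∧ ε * n - D ≤ birkhoffSum S F n x} := by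
      ext x
      simp [E, Filter.frequently_atTop]
    rw [h1]
    refine MeasurableSet.iUnion fun D => MeasurableSet.iInter fun a => MeasurableSet.iUnion fun n =>
      (MeasurableSet.const _).inter ?_
    exact measurableSet_le measurable_const (measurable_birkhoffSum hS.measurable hF n)
  have hSE : S ⁻¹' E = E := by
    ext x
    obtain ⟨D', hD'⟩ := exists_nat_ge (C + ε)
    have hx := abs_le.1 (hC x)
    constructor
    · rintro ⟨D, hD⟩
      refine ⟨D + D', ?_⟩
      rw [Filter.frequently_atTop] at hD ⊢
      intro a
      obtain ⟨n, han, hn⟩ := hD a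
      refine ⟨n + 1, by omega, ?_⟩
      rw [birkhoffSum_succ']
      push_cast
      linarith
    · rintro ⟨D, hD⟩
      refine ⟨D + D', ?_⟩
      rw [Filter.frequently_atTop] at hD
      refine Filter.frequently_atTop.2 fun a => ?_
      obtain ⟨n, han, hn⟩ := hD (a + 1)
      obtain ⟨n, rfl⟩ := Nat.exists_eq_add_of_le' (show 1 ≤ n by omega)
      refine ⟨n, by omega, ?_⟩
      rw [birkhoffSum_succ'] at hn
      push_cast at hn ⊢
      linarith
  -- Half of ε absorbs the slack: ε n - D exceeds n ε / 2 once n > 2 D / ε. The other half forces E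
  -- to be null.
  have hpos : 0 ≤ ∫ x in E, (F x - ε / 2) ∂μ := by
    refine setIntegral_nonneg_of_forall_exists_birkhoffSum_pos hS (hF.sub_const _)
      (C := C + ε / 2) (fun x => ?_) hE hSE ?_
    · have := abs_sub (F x) (ε / 2)
      rw [abs_of_pos (half_pos hε)] at this
      linarith [hC x]
    · rintro x ⟨D, hD⟩
      obtain ⟨a, ha⟩ := exists_nat_gt (2 * D / ε)
      obtain ⟨n, han, hn⟩ := (Filter.frequently_atTop.1 hD) a
      refine ⟨n, ?_⟩
      have h1 : birkhoffSum S (fun x => F x - ε / 2) n x = birkhoffSum S F n x - n * (ε / 2) := by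
        simp [birkhoffSum, Finset.sum_sub_distrib]
      rw [h1]
      rw [div_lt_iff₀ hε] at ha
      have h2 : (a : ℝ) ≤ n := by exact_mod_cast han
      nlinarith
  rw [integral_sub (integrable_of_forall_abs_le hF hC).integrableOn (integrable_const _),
    setIntegral_const, smul_eq_mul] at hpos
  have hE0 : μ.real E = 0 := by
    have := hinv E hE hSE
    have h0 : 0 ≤ μ.real E := measureReal_nonneg
    nlinarith
  have hE0' : μ E = 0 := by
    rwa [measureReal_def, ENNReal.toReal_eq_zero_iff, or_iff_left (measure_ne_top μ E)] at hE0
  filter_upwards [measure_eq_zero_iff_ae_notMem.1 hE0'] with x hx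
  by_contra hcon
  refine hx ⟨0, ?_⟩
  rw [Filter.not_eventually] at hcon
  exact hcon.mono fun n hn => by simpa using hn

end MaximalErgodic

/-! ### Compact integral operators with indicator kernels. -/

section KernelOperator

open scoped ComplexConjugate InnerProductSpace

variable {X : Type*} [MeasurableSpace X] {μ : Measure X}

theorem norm_sq_eq_integral (h : Lp ℂ 2 μ) : ‖h‖ ^ 2 = ∫ x, ‖h x‖ ^ 2 ∂μ := by
  have h1 : ((‖h‖ ^ 2 : ℝ) : ℂ) = ((∫ x, ‖h x‖ ^ 2 ∂μ : ℝ) : ℂ) := by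
    rw [← integral_complex_ofReal]
    have := inner_self_eq_norm_sq_to_K (𝕜 := ℂ) h
    rw [L2.inner_def] at this
    push_cast
    refine Eq.trans this.symm (integral_congr_ae (ae_of_all _ fun x => ?_))
    simp only [inner_self_eq_norm_sq_to_K]
    norm_cast
  exact_mod_cast h1

theorem integrable_norm_sq (h : Lp ℂ 2 μ) : Integrable (fun x => ‖h x‖ ^ 2) μ :=
  (memLp_two_iff_integrable_sq_norm (Lp.aestronglyMeasurable h)).1 (Lp.memLp h)

variable [IsProbabilityMeasure μ]

theorem integrable_conj_mul_prod (h k : Lp ℂ 2 μ) :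
    Integrable (fun z : X × X => conj (h z.1) * k z.2) (μ.prod μ) := by
  have hh : Integrable (fun x => conj (h x)) μ :=
    ((Lp.memLp h).integrable one_le_two).norm.mono'
      (RCLike.continuous_conj.comp_aestronglyMeasurable (Lp.aestronglyMeasurable h))
      (ae_of_all _ fun x => by simp)
  exact hh.mul_prod ((Lp.memLp k).integrable one_le_two)

/-- Cauchy–Schwarz on X × X for 1_E against |h| ⊗ |k|. The square root is the Hilbert–Schmidt norm
of the kernel, and its smallness for small E yields norm convergence of the operators. -/
theorem norm_setIntegral_conj_mul_le {E : Set (X × X)} (hE : MeasurableSet E) (h k : Lp ℂ 2 μ) :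
    ‖∫ z in E, conj (h z.1) * k z.2 ∂(μ.prod μ)‖
      ≤ √((μ.prod μ).real E) * ‖h‖ * ‖k‖ := by
  let φ : X × X → ℝ := fun z => ‖h z.1‖ * ‖k z.2‖
  have hφm : AEStronglyMeasurable φ (μ.prod μ) := by
    have := (integrable_conj_mul_prod h k).aestronglyMeasurable.norm
    simpa [φ] using this
  have hφ2 : Integrable (fun z => ‖φ z‖ ^ 2) (μ.prod μ) := by
    have := (integrable_norm_sq h).mul_prod (integrable_norm_sq k)
    refine this.congr (ae_of_all _ fun z => ?_)
    simp [φ, mul_pow]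
  have hφL : MemLp φ 2 (μ.prod μ) := (memLp_two_iff_integrable_sq_norm hφm).2 hφ2
  have hind : MemLp (E.indicator fun _ => (1 : ℝ)) 2 (μ.prod μ) :=
    memLp_indicator_const 2 hE 1 (Or.inr (measure_ne_top _ _))
  have key := integral_mul_le_Lp_mul_Lq_of_nonneg (μ := μ.prod μ) Real.HolderConjugate.two_two
    (f := E.indicator fun _ => (1 : ℝ)) (g := φ)
    (ae_of_all _ fun z => Set.indicator_nonneg (fun _ _ => zero_le_one) z)
    (ae_of_all _ fun z => by positivity) (by simpa using hind) (by simpa using hφL)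
  have e1 : ∫ z, E.indicator (fun _ => (1 : ℝ)) z ^ (2 : ℝ) ∂(μ.prod μ) = (μ.prod μ).real E := by
    rw [← integral_indicator_one hE]
    refine integral_congr_ae (ae_of_all _ fun z => ?_)
    by_cases hz : z ∈ E <;> simp [hz]
  have e2 : ∫ z, φ z ^ (2 : ℝ) ∂(μ.prod μ) = (‖h‖ * ‖k‖) ^ 2 := by
    rw [mul_pow, norm_sq_eq_integral, norm_sq_eq_integral, ← integral_prod_mul]
    refine integral_congr_ae (ae_of_all _ fun z => ?_)
    simp [φ, mul_pow]
  rw [e1, e2, ← Real.sqrt_eq_rpow, ← Real.sqrt_eq_rpow, Real.sqrt_sq (by positivity),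
    ← mul_assoc] at key
  refine le_trans (norm_integral_le_integral_norm _) (le_trans (le_of_eq ?_) key)
  rw [← integral_indicator hE]
  refine integral_congr_ae (ae_of_all _ fun z => ?_)
  by_cases hz : z ∈ E <;> simp [hz, φ]

/-- The sesquilinear form with kernel the indicator function of `E`. -/
noncomputable def kernelForm (μ : Measure X) [IsProbabilityMeasure μ] (E : Set (X × X)) :
    Lp ℂ 2 μ →ₗ⋆[ℂ] Lp ℂ 2 μ →ₗ[ℂ] ℂ :=
  LinearMap.mk₂'ₛₗ (starRingEnd ℂ) (RingHom.id ℂ)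
    (fun h k => ∫ z in E, conj (h z.1) * k z.2 ∂(μ.prod μ))
    (fun h h' k => by
      rw [← integral_add (integrable_conj_mul_prod h k).integrableOn
        (integrable_conj_mul_prod h' k).integrableOn]
      refine integral_congr_ae (ae_restrict_of_ae ?_)
      filter_upwards [Measure.quasiMeasurePreserving_fst.ae (Lp.coeFn_add h h')] with z hz
      rw [hz, Pi.add_apply, map_add, add_mul])
    (fun c h k => by
      rw [smul_eq_mul, ← integral_const_mul]
      refine integral_congr_ae (ae_restrict_of_ae ?_)
      filter_upwards [Measure.quasiMeasurePreserving_fst.ae (Lp.coeFn_smul c h)] with z hz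
      rw [hz, Pi.smul_apply, smul_eq_mul, map_mul, mul_assoc])
    (fun h k k' => by
      rw [← integral_add (integrable_conj_mul_prod h k).integrableOn
        (integrable_conj_mul_prod h k').integrableOn]
      refine integral_congr_ae (ae_restrict_of_ae ?_)
      filter_upwards [Measure.quasiMeasurePreserving_snd.ae (Lp.coeFn_add k k')] with z hz
      rw [hz, Pi.add_apply, mul_add])
    (fun c h k => by
      rw [smul_eq_mul, RingHom.id_apply, ← integral_const_mul]
      refine integral_congr_ae (ae_restrict_of_ae ?_)
      filter_upwards [Measure.quasiMeasurePreserving_snd.ae (Lp.coeFn_smul c k)] with z hz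
      rw [hz, Pi.smul_apply, smul_eq_mul, mul_left_comm])

theorem norm_kernelForm_le {E : Set (X × X)} (hE : MeasurableSet E) (h k : Lp ℂ 2 μ) :
    ‖kernelForm μ E h k‖ ≤ √((μ.prod μ).real E) * ‖h‖ * ‖k‖ :=
  norm_setIntegral_conj_mul_le hE h k

/-- The integral operator on `L²(X, μ)` whose kernel is the indicator function of `E`. -/
noncomputable def kernelOp (μ : Measure X) [IsProbabilityMeasure μ] {E : Set (X × X)}
    (hE : MeasurableSet E) : Lp ℂ 2 μ →L[ℂ] Lp ℂ 2 μ :=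
  InnerProductSpace.continuousLinearMapOfBilin
    ((kernelForm μ E).mkContinuous₂ _ (norm_kernelForm_le hE))

theorem inner_kernelOp {E : Set (X × X)} (hE : MeasurableSet E) (h k : Lp ℂ 2 μ) :
    ⟪kernelOp μ hE h, k⟫_ℂ = ∫ z in E, conj (h z.1) * k z.2 ∂(μ.prod μ) := by
  rw [kernelOp, InnerProductSpace.continuousLinearMapOfBilin_apply, LinearMap.mkContinuous₂_apply]
  rfl

theorem norm_kernelOp_le {E : Set (X × X)} (hE : MeasurableSet E) :
    ‖kernelOp μ hE‖ ≤ √((μ.prod μ).real E) := by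
  refine ContinuousLinearMap.opNorm_le_bound _ (Real.sqrt_nonneg _) fun h => ?_
  by_cases h0 : ‖kernelOp μ hE h‖ = 0
  · rw [h0]
    positivity
  · have h1 : ‖kernelOp μ hE h‖ * ‖kernelOp μ hE h‖
        ≤ √((μ.prod μ).real E) * ‖h‖ * ‖kernelOp μ hE h‖ := by
      have h2 := inner_self_eq_norm_mul_norm (𝕜 := ℂ) (kernelOp μ hE h)
      rw [← h2]
      refine (RCLike.re_le_norm _).trans ?_
      rw [inner_kernelOp]
      exact norm_setIntegral_conj_mul_le hE h _
    exact le_of_mul_le_mul_right h1 (lt_of_le_of_ne (norm_nonneg _) (Ne.symm h0))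

theorem kernelOp_union {E F : Set (X × X)} (hE : MeasurableSet E) (hF : MeasurableSet F)
    (hEF : Disjoint E F) :
    kernelOp μ (hE.union hF) = kernelOp μ hE + kernelOp μ hF := by
  ext1 h
  refine ext_inner_right ℂ fun k => ?_
  rw [add_apply, inner_add_left, inner_kernelOp, inner_kernelOp,
    inner_kernelOp]
  exact setIntegral_union hEF hF (integrable_conj_mul_prod h k).integrableOn
    (integrable_conj_mul_prod h k).integrableOn

theorem kernelOp_congr {E F : Set (X × X)} (hE : MeasurableSet E) (hF : MeasurableSet F)
    (hEF : E = F) : kernelOp μ hE = kernelOp μ hF := by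
  subst hEF
  rfl

theorem isCompactOperator_kernelOp_prod {s t : Set X} (hs : MeasurableSet s)
    (ht : MeasurableSet t) : IsCompactOperator (kernelOp μ (hs.prod ht)) := by
  let a : Lp ℂ 2 μ := indicatorConstLp 2 hs (measure_ne_top μ s) (1 : ℂ)
  let b : Lp ℂ 2 μ := indicatorConstLp 2 ht (measure_ne_top μ t) (1 : ℂ)
  have h1 : kernelOp μ (hs.prod ht)
      = (ContinuousLinearMap.toSpanSingleton ℂ b).comp (innerSL ℂ a) := by
    ext1 h
    refine ext_inner_right ℂ fun k => ?_
    rw [inner_kernelOp, ContinuousLinearMap.comp_apply, ContinuousLinearMap.toSpanSingleton_apply,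
      innerSL_apply_apply, inner_smul_left, L2.inner_indicatorConstLp_one,
      L2.inner_indicatorConstLp_one, setIntegral_prod_mul (fun x => conj (h x)) (fun x => k x),
      integral_conj]
  rw [h1]
  exact (isCompactOperator_of_locallyCompactSpace_dom
    (innerSL ℂ a : Lp ℂ 2 μ →L[ℂ] ℂ)).clm_comp (ContinuousLinearMap.toSpanSingleton ℂ b)

/-- Rectangles give operators of rank at most one. Complements and finite disjoint unions become
differences and sums, and a countable disjoint union becomes a norm limit, since the measure of the
tail tends to zero. -/
theorem isCompactOperator_kernelOp {E : Set (X × X)} (hE : MeasurableSet E) :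
    IsCompactOperator (kernelOp μ hE) := by
  induction E, hE using MeasurableSpace.induction_on_inter generateFrom_prod.symm
    isPiSystem_prod with
  | empty =>
    rw [kernelOp_congr _ (MeasurableSet.univ.prod MeasurableSet.empty) Set.prod_empty.symm]
    exact isCompactOperator_kernelOp_prod MeasurableSet.univ MeasurableSet.empty
  | basic t ht =>
    obtain ⟨s, hs, u, hu, rfl⟩ := ht
    exact isCompactOperator_kernelOp_prod hs hu
  | compl t htm ih =>
    have h1 := kernelOp_union (μ := μ) htm htm.compl disjoint_compl_right
    rw [kernelOp_congr _ (MeasurableSet.univ.prod MeasurableSet.univ)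
      ((Set.union_compl_self t).trans Set.univ_prod_univ.symm)] at h1
    rw [eq_sub_of_add_eq' h1.symm]
    exact (isCompactOperator_kernelOp_prod MeasurableSet.univ MeasurableSet.univ).sub ih
  | iUnion f hd hfm ih =>
    let P : ℕ → Set (X × X) := fun n => ⋃ i ∈ Finset.range n, f i
    have hP : ∀ n, MeasurableSet (P n) := fun n =>
      Finset.measurableSet_biUnion _ fun i _ => hfm i
    have hPsub : ∀ n, P n ⊆ ⋃ i, f i := fun n =>
      Set.iUnion₂_subset fun i _ => Set.subset_iUnion f i
    have hPc : ∀ n, IsCompactOperator (kernelOp μ (hP n)) := by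
      intro n
      induction n with
      | zero =>
        rw [kernelOp_congr _ (MeasurableSet.univ.prod MeasurableSet.empty) (by simp [P])]
        exact isCompactOperator_kernelOp_prod MeasurableSet.univ MeasurableSet.empty
      | succ n ihn =>
        have h1 : Disjoint (P n) (f n) := by
          rw [Set.disjoint_iUnion₂_left]
          intro i hi
          exact hd (Finset.mem_range.1 hi).ne
        rw [kernelOp_congr _ ((hP n).union (hfm n)) (by
          simp only [P]
          rw [Finset.range_add_one, Finset.set_biUnion_insert, Set.union_comm]),
          kernelOp_union (hP n) (hfm n) h1]
        exact ihn.add (ih n)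
    have hdiff : ∀ n, kernelOp μ (MeasurableSet.iUnion hfm) - kernelOp μ (hP n)
        = kernelOp μ ((MeasurableSet.iUnion hfm).diff (hP n)) := fun n => by
      rw [sub_eq_iff_eq_add', ← kernelOp_union (hP n) ((MeasurableSet.iUnion hfm).diff (hP n)) Set.disjoint_sdiff_right]
      exact kernelOp_congr _ _ (Set.union_sdiff_cancel (hPsub n)).symm
    have hlim : Tendsto (fun n => √((μ.prod μ).real ((⋃ i, f i) \ P n))) atTop (𝓝 0) := by
      have h1 : Tendsto (fun n => (μ.prod μ) ((⋃ i, f i) \ P n)) atTop (𝓝 0) := by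
        have h2 : ⋂ n, ((⋃ i, f i) \ P n) = ∅ := by
          ext z
          simp only [Set.mem_iInter, Set.mem_sdiff, Set.mem_iUnion, Set.mem_empty_iff_false,
            iff_false, not_forall, P]
          by_cases hz : ∃ i, z ∈ f i
          · obtain ⟨i, hi⟩ := hz
            exact ⟨i + 1, fun h => h.2 ⟨i, Finset.mem_range.2 (Nat.lt_succ_self i), hi⟩⟩
          · exact ⟨0, fun h => hz h.1⟩
        rw [← measure_empty (μ := μ.prod μ), ← h2]
        refine tendsto_measure_iInter_atTop
          (fun n => ((MeasurableSet.iUnion hfm).diff (hP n)).nullMeasurableSet) ?_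
          ⟨0, measure_ne_top _ _⟩
        intro m n hmn
        refine Set.sdiff_subset_sdiff_right (Set.biUnion_subset_biUnion_left fun i hi => ?_)
        simp only [Finset.coe_range, Set.mem_Iio] at hi ⊢
        omega
      have h3 := (Real.continuous_sqrt.tendsto _).comp
        ((ENNReal.tendsto_toReal ENNReal.zero_ne_top).comp h1)
      simpa [Function.comp_def, measureReal_def] using h3
    refine isCompactOperator_of_tendsto (l := atTop) (F := fun n => kernelOp μ (hP n)) ?_
      (Eventually.of_forall hPc)
    rw [tendsto_iff_norm_sub_tendsto_zero]
    refine squeeze_zero (fun n => norm_nonneg _) (fun n => ?_) hlim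
    rw [norm_sub_rev, hdiff]
    exact norm_kernelOp_le _

end KernelOperator

/-! ### Orthogonality to the eigenfunctions and invariant sets of the product. -/

section Kronecker

open scoped ComplexConjugate InnerProductSpace

section Abstract

variable {H : Type*} [NormedAddCommGroup H] [InnerProductSpace ℂ H]

/-- A finite-dimensional subspace invariant under a linear isometry is spanned by eigenvectors. -/
theorem le_span_eigenvectors_of_finiteDimensional (U : H →ₗᵢ[ℂ] H) (V : Submodule ℂ H)
    [FiniteDimensional ℂ V] (hV : ∀ v ∈ V, U v ∈ V) :
    V ≤ Submodule.span ℂ {h : H | ∃ c : ℂ, Module.End.HasEigenvector U.toLinearMap c h} := by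
  set K := Submodule.span ℂ {h : H | ∃ c : ℂ, Module.End.HasEigenvector U.toLinearMap c h}
  let W := V ⊓ K
  have hUK : ∀ v ∈ K, U v ∈ K := by
    intro v hv
    refine Submodule.span_induction (p := fun v _ => U v ∈ K) ?_ ?_ ?_ ?_ hv
    · rintro x ⟨c, hc⟩
      have h1 : U x = c • x := hc.apply_eq_smul
      rw [h1]
      exact K.smul_mem _ (Submodule.subset_span ⟨c, hc⟩)
    · simp
    · intro x y _ _ hx hy
      rw [map_add]
      exact K.add_mem hx hy
    · intro a x _ hx
      rw [map_smul]
      exact K.smul_mem _ hx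
  have hUW : ∀ v ∈ W, U.toLinearMap v ∈ W := fun v hv => ⟨hV v hv.1, hUK v hv.2⟩
  have hWfin : FiniteDimensional ℂ W := Submodule.finiteDimensional_inf_left V K
  -- In finite dimension the injective map U is onto W, so the isometry U also preserves
  -- orthogonality to W. An eigenvector in the complement of W inside V would lie in W itself.
  have hsurj : Function.Surjective (U.toLinearMap.restrict hUW) := by
    refine LinearMap.surjective_of_injective fun a b hab => ?_
    have h1 : U a = U b := congrArg Subtype.val hab
    exact Subtype.ext (U.injective h1)
  have hZ : Wᗮ ⊓ V = ⊥ := by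
    have hZinv : ∀ z ∈ Wᗮ ⊓ V, U.toLinearMap z ∈ Wᗮ ⊓ V := by
      rintro z ⟨hz1, hz2⟩
      refine ⟨(Submodule.mem_orthogonal _ _).2 fun w hw => ?_, hV z hz2⟩
      obtain ⟨w', hw'⟩ := hsurj ⟨w, hw⟩
      have h1 : U w' = w := congrArg Subtype.val hw'
      rw [← h1]
      exact (U.inner_map_map _ _).trans ((Submodule.mem_orthogonal _ _).1 hz1 _ w'.2)
    have hZfin : FiniteDimensional ℂ (Wᗮ ⊓ V : Submodule ℂ H) :=
      Submodule.finiteDimensional_inf_right _ _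
    by_contra hne
    have : Nontrivial (Wᗮ ⊓ V : Submodule ℂ H) := Submodule.nontrivial_iff_ne_bot.2 hne
    obtain ⟨c, hc⟩ := Module.End.exists_eigenvalue (U.toLinearMap.restrict hZinv)
    obtain ⟨z, hz⟩ := hc.exists_hasEigenvector
    have h1 : U (z : H) = c • (z : H) := congrArg Subtype.val hz.apply_eq_smul
    have h0 : (z : H) ≠ 0 := fun h => hz.2 (Subtype.ext h)
    have hzK : (z : H) ∈ K :=
      Submodule.subset_span ⟨c, Module.End.mem_eigenspace_iff.2 h1, h0⟩
    exact h0 (inner_self_eq_zero.1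
      ((Submodule.mem_orthogonal _ _).1 z.2.1 (z : H) ⟨z.2.2, hzK⟩))
  have hsup := Submodule.sup_orthogonal_inf_of_hasOrthogonalProjection
    (K₁ := W) (K₂ := V) inf_le_left
  rw [hZ, sup_bot_eq] at hsup
  exact hsup ▸ inf_le_right

/-- A compact operator which is invariant under conjugation by a unitary operator `U` vanishes on
the orthogonal complement of the eigenvectors of `U`. -/
theorem compactOperator_apply_eq_zero [CompleteSpace H] (U : H →ₗᵢ[ℂ] H)
    (hU : Function.Surjective U) (A : H →L[ℂ] H) (hA : IsCompactOperator A)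
    (hAU : ∀ h k, ⟪A (U h), U k⟫_ℂ = ⟪A h, k⟫_ℂ) {f : H}
    (hf : f ∈ ((Submodule.span ℂ
      {h : H | ∃ c : ℂ, Module.End.HasEigenvector U.toLinearMap c h}).topologicalClosure)ᗮ) :
    A f = 0 := by
  have hcomm : ∀ h, A (U h) = U (A h) := by
    intro h
    refine ext_inner_right ℂ fun k => ?_
    obtain ⟨k, rfl⟩ := hU k
    rw [hAU, U.inner_map_map]
  -- A need not be self-adjoint, so the spectral theorem is applied to A*A, which has the same
  -- kernel.
  let B : H →L[ℂ] H := (ContinuousLinearMap.adjoint A).comp A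
  have hBinner : ∀ h k, ⟪B h, k⟫_ℂ = ⟪A h, A k⟫_ℂ := fun h k =>
    ContinuousLinearMap.adjoint_inner_left A k (A h)
  have hBcomm : ∀ h, B (U h) = U (B h) := by
    intro h
    refine ext_inner_right ℂ fun k => ?_
    obtain ⟨k, rfl⟩ := hU k
    rw [hBinner, hcomm, hcomm, U.inner_map_map, U.inner_map_map, hBinner]
  have hBc : IsCompactOperator B := hA.clm_comp (ContinuousLinearMap.adjoint A)
  have hBs : (B : H →ₗ[ℂ] H).IsSymmetric := fun h k =>
    (hBinner h k).trans (ContinuousLinearMap.adjoint_inner_right A h (A k)).symm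
  have hBf : B f = 0 := by
    -- B f is orthogonal to every eigenspace of B: the kernel contributes nothing, and the others
    -- lie in the span of eigenvectors of U. By the spectral theorem B f = 0.
    have h1 : B f ∈ (⨆ c, Module.End.eigenspace (B : Module.End ℂ H) c)ᗮ := by
      rw [Submodule.mem_orthogonal]
      intro v hv
      refine Submodule.iSup_induction _ (motive := fun v => ⟪v, B f⟫_ℂ = 0) hv ?_ (by simp) ?_
      · intro c v hv
        have hv' : B v = c • v := Module.End.mem_eigenspace_iff.1 hv
        have h2 : ⟪v, B f⟫_ℂ = ⟪B v, f⟫_ℂ := (hBs v f).symm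
        rw [h2, hv']
        by_cases hc : c = 0
        · simp [hc]
        · have hfin : FiniteDimensional ℂ (Module.End.eigenspace (B : Module.End ℂ H) c) :=
            ContinuousLinearMap.finite_dimensional_eigenspace hBc c hc
          have h3 := le_span_eigenvectors_of_finiteDimensional U
            (Module.End.eigenspace (B : Module.End ℂ H) c) (fun w hw => by
              have hw' : B w = c • w := Module.End.mem_eigenspace_iff.1 hw
              refine Module.End.mem_eigenspace_iff.2 ?_
              change B (U w) = c • U w
              rw [hBcomm, hw', map_smul]) hv
          rw [inner_smul_left, (Submodule.mem_orthogonal _ _).1 hf v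
            (Submodule.le_topologicalClosure _ h3), mul_zero]
      · intro x y hx hy
        rw [inner_add_left, hx, hy, add_zero]
    rw [ContinuousLinearMap.orthogonalComplement_iSup_eigenspaces_eq_bot hBc hBs] at h1
    exact (Submodule.mem_bot ℂ).1 h1
  have h2 := hBinner f f
  rw [hBf, inner_zero_left] at h2
  exact inner_self_eq_zero.1 h2.symm

end Abstract

variable {X : Type*} [MeasurableSpace X] {μ : Measure X} {T : X → X}

theorem koopman_coeFn (hT : MeasurePreserving T μ μ) (h : Lp ℂ 2 μ) :
    koopman hT h =ᵐ[μ] fun x => h (T x) :=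
  Lp.coeFn_compMeasurePreserving h hT

/-- The almost-everywhere inverse T' also preserves μ, so its Koopman operator supplies preimages.
-/
theorem koopman_surjective (hT : MeasurePreserving T μ μ) (hTinv : IsAEInvertible T μ) :
    Function.Surjective (koopman hT) := by
  obtain ⟨T', hT'm, hl, hr⟩ := hTinv
  have hT' : MeasurePreserving T' μ μ := by
    refine ⟨hT'm, ?_⟩
    conv_lhs => rw [← hT.map_eq]
    rw [Measure.map_map hT'm hT.measurable]
    have h1 : T' ∘ T =ᵐ[μ] id := hl
    rw [Measure.map_congr h1, Measure.map_id]
  intro h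
  refine ⟨koopman hT' h, Lp.ext ?_⟩
  filter_upwards [koopman_coeFn hT (koopman hT' h),
    hT.quasiMeasurePreserving.ae (koopman_coeFn hT' h), hl] with x h1 h2 h3
  rw [h1, h2, h3]

theorem setIntegral_invariant_eq_zero [IsProbabilityMeasure μ] (hT : MeasurePreserving T μ μ)
    (hTinv : IsAEInvertible T μ) {f : Lp ℂ 2 μ} (hf : f ∈ (kroneckerFactor hT)ᗮ)
    {E : Set (X × X)} (hE : MeasurableSet E) (hEinv : Prod.map T T ⁻¹' E = E) :
    ∫ z in E, conj (f z.1) * f z.2 ∂(μ.prod μ) = 0 := by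
  have h0 : kernelOp μ hE f = 0 := by
    refine compactOperator_apply_eq_zero (koopman hT) (koopman_surjective hT hTinv) _
      (isCompactOperator_kernelOp hE) (fun h k => ?_) hf
    rw [inner_kernelOp, inner_kernelOp]
    have hTT : MeasurePreserving (Prod.map T T) (μ.prod μ) (μ.prod μ) := hT.prod hT
    have h1 : ∫ z in E, conj (koopman hT h z.1) * koopman hT k z.2 ∂(μ.prod μ)
        = ∫ z in Prod.map T T ⁻¹' E,
          (fun w : X × X => conj (h w.1) * k w.2) (Prod.map T T z) ∂(μ.prod μ) := by
      rw [hEinv]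
      refine integral_congr_ae (ae_restrict_of_ae ?_)
      filter_upwards [Measure.quasiMeasurePreserving_fst.ae (koopman_coeFn hT h),
        Measure.quasiMeasurePreserving_snd.ae (koopman_coeFn hT k)] with z hz1 hz2
      rw [hz1, hz2]
      rfl
    have h2 := setIntegral_map (μ := μ.prod μ) hE
      (f := fun w : X × X => conj (h w.1) * k w.2)
      (by rw [hTT.map_eq]; exact (integrable_conj_mul_prod h k).aestronglyMeasurable)
      hTT.measurable.aemeasurable
    rw [hTT.map_eq] at h2
    rw [h1, ← h2]
  rw [← inner_kernelOp hE, h0, inner_zero_left]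

end Kronecker

/-! ### Nearly orthogonal packets along a sequence. -/

section Combinatorics

open scoped ComplexConjugate

/-- The correlation of the word `c 0, …, c (n - 1)` with the word read in `v` at position `m`. -/
noncomputable def wordCorr (c v : ℕ → ℂ) (m n : ℕ) : ℂ :=
  ∑ k ∈ Finset.range n, v (m + k) * conj (c k)

/-- The positions at which `v` correlates with an initial word of `c` whose length lies in
`[L, R]`. -/
def corrSet (c v : ℕ → ℂ) (δ : ℝ) (L R : ℕ) : Set ℕ :=
  {m | ∃ n, L ≤ n ∧ n ≤ R ∧ δ * n < ‖wordCorr c v m n‖}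

open Classical in
/-- The number of elements of `s` below `n`. -/
noncomputable def countBelow (s : Set ℕ) (n : ℕ) : ℕ := ((Finset.range n).filter (· ∈ s)).card

theorem countBelow_mono {s t : Set ℕ} (h : s ⊆ t) (n : ℕ) : countBelow s n ≤ countBelow t n := by
  classical
  exact Finset.card_le_card (Finset.monotone_filter_right _ fun _ _ hx => h hx)

theorem countBelow_union_le (s t : Set ℕ) (n : ℕ) :
    countBelow (s ∪ t) n ≤ countBelow s n + countBelow t n := by
  classical
  unfold countBelow
  refine le_trans (Finset.card_le_card ?_) (Finset.card_union_le _ _)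
  intro x hx
  simp only [Finset.mem_filter, Finset.mem_union, Set.mem_union] at hx ⊢
  tauto

theorem corrSet_mono (c v : ℕ → ℂ) (δ : ℝ) {L L' R R' : ℕ} (hL : L' ≤ L) (hR : R ≤ R') :
    corrSet c v δ L R ⊆ corrSet c v δ L' R' :=
  fun _ ⟨n, h1, h2, h3⟩ => ⟨n, hL.trans h1, h2.trans hR, h3⟩

/-- The triangle inequality makes thresholds add, which is why a superposition of r packets is
controlled at threshold r * δ. -/
theorem corrSet_add_subset (c v w : ℕ → ℂ) (δ δ' : ℝ) (L R : ℕ) :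
    corrSet c (fun m => v m + w m) (δ + δ') L R ⊆ corrSet c v δ L R ∪ corrSet c w δ' L R := by
  rintro m ⟨n, h1, h2, h3⟩
  have h4 : wordCorr c (fun m => v m + w m) m n = wordCorr c v m n + wordCorr c w m n := by
    simp [wordCorr, add_mul, Finset.sum_add_distrib]
  rw [h4] at h3
  by_contra hcon
  simp only [corrSet, Set.mem_union, Set.mem_ofPred_eq, not_or, not_exists, not_and, not_lt] at hcon
  have h5 := hcon.1 n h1 h2
  have h6 := hcon.2 n h1 h2
  have h7 := norm_add_le (wordCorr c v m n) (wordCorr c w m n)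
  linarith

/-- A greedy covering lemma. -/
theorem exists_disjoint_Ico_cover (B : Finset ℕ) (ℓ : ℕ → ℕ) (hℓ : ∀ a ∈ B, 1 ≤ ℓ a) :
    ∃ A ⊆ B, (∀ a ∈ A, ∀ b ∈ A, a < b → a + ℓ a ≤ b) ∧
      B ⊆ A.biUnion fun a => Finset.Ico a (a + ℓ a) := by
  induction B using Finset.strongInduction with
  | H B ih =>
    rcases B.eq_empty_or_nonempty with rfl | hB
    · exact ⟨∅, by simp⟩
    · set a := B.min' hB
      have haB : a ∈ B := B.min'_mem hB
      have hss : B.filter (fun b => a + ℓ a ≤ b) ⊂ B := by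
        refine Finset.filter_ssubset.2 ⟨a, haB, ?_⟩
        have := hℓ a haB
        omega
      obtain ⟨A, hAB, hA1, hA2⟩ := ih _ hss fun b hb => hℓ b (Finset.mem_filter.1 hb).1
      refine ⟨insert a A, ?_, ?_, ?_⟩
      · exact Finset.insert_subset haB (hAB.trans (Finset.filter_subset _ _))
      · intro x hx y hy hxy
        rcases Finset.mem_insert.1 hx with rfl | hx' <;> rcases Finset.mem_insert.1 hy with rfl | hy'
        · omega
        · exact (Finset.mem_filter.1 (hAB hy')).2
        · have := (Finset.mem_filter.1 (hAB hx')).2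
          omega
        · exact hA1 x hx' y hy' hxy
      · intro b hb
        rw [Finset.mem_biUnion]
        by_cases hab : a + ℓ a ≤ b
        · obtain ⟨x, hx, hx'⟩ := Finset.mem_biUnion.1 (hA2 (Finset.mem_filter.2 ⟨hb, hab⟩))
          exact ⟨x, Finset.mem_insert_of_mem hx, hx'⟩
        · exact ⟨a, Finset.mem_insert_self _ _,
            Finset.mem_Ico.2 ⟨B.min'_le b hb, not_le.1 hab⟩⟩

/-- The sequence which carries on each interval `[a, a + ℓ a)`, `a ∈ A`, a copy of the beginning
of `c`. -/
noncomputable def packet (c : ℕ → ℂ) (A : Finset ℕ) (ℓ : ℕ → ℕ) (m : ℕ) : ℂ :=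
  ∑ a ∈ A, if m ∈ Finset.Ico a (a + ℓ a) then c (m - a) else 0

section Packet

variable {c : ℕ → ℂ} {A : Finset ℕ} {ℓ : ℕ → ℕ}

theorem conj_packet (c : ℕ → ℂ) (A : Finset ℕ) (ℓ : ℕ → ℕ) (m : ℕ) :
    conj (packet c A ℓ m) = packet (fun k => conj (c k)) A ℓ m := by
  rw [packet, packet, map_sum]
  refine Finset.sum_congr rfl fun a _ => ?_
  split_ifs <;> simp

theorem packet_apply (hA : ∀ a ∈ A, ∀ b ∈ A, a < b → a + ℓ a ≤ b) {a k : ℕ} (ha : a ∈ A)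
    (hk : k < ℓ a) : packet c A ℓ (a + k) = c k := by
  rw [packet, Finset.sum_eq_single_of_mem a ha, if_pos (Finset.mem_Ico.2 ⟨by omega, by omega⟩),
    Nat.add_sub_cancel_left]
  intro b hb hba
  refine if_neg fun h => ?_
  rw [Finset.mem_Ico] at h
  rcases lt_or_gt_of_ne hba with h1 | h1
  · have := hA b hb a ha h1
    omega
  · have := hA a ha b hb h1
    omega

theorem packet_eq_zero {m : ℕ} (hm : ∀ a ∈ A, m ∉ Finset.Ico a (a + ℓ a)) :
    packet c A ℓ m = 0 :=
  Finset.sum_eq_zero fun a ha => if_neg (hm a ha)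

theorem norm_packet_le (hA : ∀ a ∈ A, ∀ b ∈ A, a < b → a + ℓ a ≤ b) {C : ℝ}
    (hC : ∀ k, ‖c k‖ ≤ C) (m : ℕ) : ‖packet c A ℓ m‖ ≤ C := by
  by_cases h : ∃ a ∈ A, m ∈ Finset.Ico a (a + ℓ a)
  · obtain ⟨a, ha, hm⟩ := h
    rw [Finset.mem_Ico] at hm
    obtain ⟨k, rfl⟩ := Nat.exists_eq_add_of_le hm.1
    rw [packet_apply hA ha (by omega)]
    exact hC k
  · push Not at h
    rw [packet_eq_zero h, norm_zero]
    exact (norm_nonneg _).trans (hC 0)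

theorem sum_mul_packet (c F : ℕ → ℂ) {N : ℕ} (hN : ∀ a ∈ A, a + ℓ a ≤ N) :
    ∑ m ∈ Finset.range N, F m * packet c A ℓ m
      = ∑ a ∈ A, ∑ k ∈ Finset.range (ℓ a), F (a + k) * c k := by
  simp only [packet, Finset.mul_sum]
  rw [Finset.sum_comm]
  refine Finset.sum_congr rfl fun a ha => ?_
  have h1 : Finset.Ico a (a + ℓ a) ⊆ Finset.range N := fun m hm => by
    rw [Finset.mem_Ico] at hm
    exact Finset.mem_range.2 (by have := hN a ha; omega)
  rw [← Finset.sum_subset h1, Finset.sum_Ico_eq_sum_range, Nat.add_sub_cancel_left]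
  · refine Finset.sum_congr rfl fun k hk => ?_
    rw [Finset.mem_range] at hk
    rw [if_pos (Finset.mem_Ico.2 ⟨by omega, by omega⟩), Nat.add_sub_cancel_left]
  · intro m _ hm
    rw [if_neg hm, mul_zero]

theorem sum_length_le (hA : ∀ a ∈ A, ∀ b ∈ A, a < b → a + ℓ a ≤ b) {N : ℕ}
    (hN : ∀ a ∈ A, a + ℓ a ≤ N) : ∑ a ∈ A, ℓ a ≤ N := by
  have h1 : (A.biUnion fun a => Finset.Ico a (a + ℓ a)).card = ∑ a ∈ A, ℓ a := by
    rw [Finset.card_biUnion]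
    · simp
    · intro a ha b hb hab
      refine Finset.disjoint_left.2 fun x hx hy => ?_
      rw [Finset.mem_Ico] at hx hy
      rcases lt_or_gt_of_ne hab with h | h
      · have := hA a ha b hb h
        omega
      · have := hA b hb a ha h
        omega
  rw [← h1, ← Finset.card_range N]
  refine Finset.card_le_card fun x hx => ?_
  obtain ⟨a, ha, hx⟩ := Finset.mem_biUnion.1 hx
  rw [Finset.mem_Ico] at hx
  exact Finset.mem_range.2 (by have := hN a ha; omega)

/-- A window of length at most R starting at m that meets a block either starts within R before it,
starts inside and runs past its end, or lies wholly inside, where the packet is a copy of c.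
Truncated subtraction only shortens the first two intervals. -/
theorem corrSet_packet_subset (hA : ∀ a ∈ A, ∀ b ∈ A, a < b → a + ℓ a ≤ b) {δ : ℝ} (hδ : 0 ≤ δ)
    (L R : ℕ) {m : ℕ} (hm : m ∈ corrSet c (packet c A ℓ) δ L R) :
    ∃ a ∈ A, m ∈ Finset.Ico (a - R) a ∨ m ∈ Finset.Ico (a + ℓ a - R) (a + ℓ a) ∨
      ∃ d < ℓ a, d ∈ corrSet c c δ L R ∧ m = a + d := by
  obtain ⟨n, h1, h2, h3⟩ := hm
  by_cases h : ∃ a ∈ A, m ∈ Finset.Ico a (a + ℓ a)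
  · obtain ⟨a, ha, hma⟩ := h
    rw [Finset.mem_Ico] at hma
    refine ⟨a, ha, Or.inr ?_⟩
    by_cases hmn : m + n ≤ a + ℓ a
    · obtain ⟨d, rfl⟩ := Nat.exists_eq_add_of_le hma.1
      refine Or.inr ⟨d, by omega, ⟨n, h1, h2, ?_⟩, rfl⟩
      have h4 : wordCorr c (packet c A ℓ) (a + d) n = wordCorr c c d n := by
        refine Finset.sum_congr rfl fun k hk => ?_
        rw [Finset.mem_range] at hk
        rw [add_assoc, packet_apply hA ha (by omega)]
      rwa [h4] at h3
    · exact Or.inl (Finset.mem_Ico.2 ⟨by omega, hma.2⟩)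
  · push Not at h
    by_contra hcon
    push Not at hcon
    have h4 : wordCorr c (packet c A ℓ) m n = 0 := by
      refine Finset.sum_eq_zero fun k hk => ?_
      rw [Finset.mem_range] at hk
      rw [packet_eq_zero, zero_mul]
      intro a ha hmk
      have h5 := h a ha
      have h6 := (hcon a ha).1
      rw [Finset.mem_Ico] at hmk h5 h6
      omega
    rw [h4, norm_zero] at h3
    exact absurd h3 (not_lt.2 (by positivity))

/-- Each block is charged at most R + R + δ ℓ(a) ≤ 3 δ ℓ(a) positions, and the lengths of the
disjoint blocks add up to at most N'. -/
theorem countBelow_corrSet_packet_le (hA : ∀ a ∈ A, ∀ b ∈ A, a < b → a + ℓ a ≤ b) {N N' : ℕ}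
    (hN : ∀ a ∈ A, a + ℓ a ≤ N') {δ : ℝ} (hδ : 0 ≤ δ) {L R L' : ℕ} (hR : R ≤ δ * L')
    (hL' : ∀ a ∈ A, L' ≤ ℓ a) (hcount : ∀ n, L' ≤ n → countBelow (corrSet c c δ L R) n ≤ δ * n) :
    countBelow (corrSet c (packet c A ℓ) δ L R) N ≤ 3 * δ * N' := by
  classical
  let D : ℕ → Finset ℕ := fun a => Finset.Ico (a - R) a ∪ (Finset.Ico (a + ℓ a - R) (a + ℓ a) ∪
    ((Finset.range (ℓ a)).filter (· ∈ corrSet c c δ L R)).image (a + ·))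
  have h1 : countBelow (corrSet c (packet c A ℓ) δ L R) N ≤ ∑ a ∈ A, (D a).card := by
    unfold countBelow
    refine le_trans (Finset.card_le_card ?_) Finset.card_biUnion_le
    intro m hm
    obtain ⟨a, ha, h⟩ := corrSet_packet_subset hA hδ L R (Finset.mem_filter.1 hm).2
    refine Finset.mem_biUnion.2 ⟨a, ha, ?_⟩
    simp only [D, Finset.mem_union, Finset.mem_image, Finset.mem_filter, Finset.mem_range]
    rcases h with h | h | ⟨d, h1, h2, h3⟩
    · exact Or.inl h
    · exact Or.inr (Or.inl h)
    · exact Or.inr (Or.inr ⟨d, ⟨h1, h2⟩, h3.symm⟩)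
  have h2 : ∀ a ∈ A, ((D a).card : ℝ) ≤ 3 * δ * ℓ a := by
    intro a ha
    have h3 : (D a).card ≤ R + (R + countBelow (corrSet c c δ L R) (ℓ a)) := by
      refine (Finset.card_union_le _ _).trans (add_le_add ?_ ((Finset.card_union_le _ _).trans
        (add_le_add ?_ Finset.card_image_le)))
      · rw [Nat.card_Ico]
        omega
      · rw [Nat.card_Ico]
        omega
    have h4 : ((D a).card : ℝ) ≤ R + (R + countBelow (corrSet c c δ L R) (ℓ a)) := by
      exact_mod_cast h3
    have h5 := hcount (ℓ a) (hL' a ha)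
    have h6 : (L' : ℝ) ≤ ℓ a := by exact_mod_cast hL' a ha
    have h7 := mul_le_mul_of_nonneg_left h6 hδ
    linarith
  have h8 : ((∑ a ∈ A, ℓ a : ℕ) : ℝ) ≤ N' := by exact_mod_cast sum_length_le hA hN
  calc (countBelow (corrSet c (packet c A ℓ) δ L R) N : ℝ) ≤ ∑ a ∈ A, ((D a).card : ℝ) := by
        exact_mod_cast h1
    _ ≤ ∑ a ∈ A, 3 * δ * ℓ a := Finset.sum_le_sum h2
    _ = 3 * δ * ((∑ a ∈ A, ℓ a : ℕ) : ℝ) := by rw [← Finset.mul_sum]; push_cast; rfl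
    _ ≤ 3 * δ * N' := by gcongr

end Packet

/-- Along a rapidly increasing list of scales `[L j, R j]`, `j < K`, one can superpose packets with
nearly orthogonal contributions, starting with the largest scales. -/
theorem exists_superposition {c G : ℕ → ℂ} {C δ ε : ℝ} (hC : ∀ k, ‖c k‖ ≤ C) (hδ : 0 ≤ δ)
    (hε : 0 ≤ ε) {K N N' : ℕ} {L R : ℕ → ℕ} (hL : ∀ j < K, 1 ≤ L j)
    (hN : ∀ j < K, N + R j ≤ N')
    (hLR : ∀ i j, i < j → j < K → (R i : ℝ) ≤ δ * L j)
    (hcount : ∀ i j, i < j → j < K → ∀ n, L j ≤ n →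
      (countBelow (corrSet c c δ (L i) (R i)) n : ℝ) ≤ δ * n)
    {B : Finset ℕ} (hBN : ∀ a ∈ B, a < N)
    (hB : ∀ a ∈ B, ∀ j < K, ∃ n, L j ≤ n ∧ n ≤ R j ∧
      ε * n ≤ (∑ k ∈ Finset.range n, G (a + k) * c k).re)
    (r : ℕ) (hr : r ≤ K) :
    ∃ v : ℕ → ℂ,
      r * (ε * (B.card - K * (3 * δ * N'))) ≤ (∑ m ∈ Finset.range N', G m * v m).re ∧
      ∑ m ∈ Finset.range N', ‖v m‖ ^ 2 ≤ r * ((C ^ 2 + 2 * (K * δ)) * N') ∧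
      ∀ i < K - r, (countBelow (corrSet c v (r * δ) (L i) (R i)) N : ℝ) ≤ r * (3 * δ * N') := by
  classical
  induction r with
  | zero =>
    refine ⟨fun _ => 0, by simp, by simp, fun i _ => ?_⟩
    have h1 : corrSet c (fun _ => 0) ((0 : ℕ) * δ) (L i) (R i) = ∅ := by
      ext m
      simp [corrSet, wordCorr]
    rw [h1]
    simp [countBelow]
  | succ r ih =>
    obtain ⟨v, hv1, hv2, hv3⟩ := ih (by omega)
    set j := K - (r + 1)
    have hjK : j < K := by omega
    have hrK : (r : ℝ) ≤ K := by exact_mod_cast (by omega : r ≤ K)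
    have hδN : 0 ≤ 3 * δ * (N' : ℝ) := by positivity
    -- A block starting in `bad` could correlate with what was laid down at the larger scales. By
    -- the count carried through the induction, avoiding such starts costs at most r * (3 * δ * N')
    -- points of B.
    set bad := corrSet c v (r * δ) (L j) (R j)
    let B' := B.filter (· ∉ bad)
    have hB'card : (B.card : ℝ) - r * (3 * δ * N') ≤ B'.card := by
      have h1 : B.card ≤ B'.card + countBelow bad N := by
        rw [← Finset.card_filter_add_card_filter_not (s := B) (· ∈ bad), add_comm]
        refine Nat.add_le_add_left (Finset.card_le_card fun a ha => ?_) _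
        rw [Finset.mem_filter] at ha ⊢
        exact ⟨Finset.mem_range.2 (hBN a ha.1), ha.2⟩
      have h2 := hv3 j (by omega)
      have h3 : (B.card : ℝ) ≤ B'.card + countBelow bad N := by exact_mod_cast h1
      linarith
    have hex : ∀ a, ∃ n, a ∈ B → L j ≤ n ∧ n ≤ R j ∧
        ε * n ≤ (∑ k ∈ Finset.range n, G (a + k) * c k).re := fun a => by
      by_cases ha : a ∈ B
      · obtain ⟨n, hn⟩ := hB a ha j hjK
        exact ⟨n, fun _ => hn⟩
      · exact ⟨0, fun h => absurd h ha⟩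
    choose ℓ hℓ using hex
    obtain ⟨A, hAB', hA, hcov⟩ := exists_disjoint_Ico_cover B' ℓ fun a ha =>
      (hL j hjK).trans (hℓ a (Finset.mem_filter.1 ha).1).1
    have hAB : ∀ a ∈ A, a ∈ B := fun a ha => (Finset.mem_filter.1 (hAB' ha)).1
    have hAbad : ∀ a ∈ A, a ∉ bad := fun a ha => (Finset.mem_filter.1 (hAB' ha)).2
    have hAN : ∀ a ∈ A, a + ℓ a ≤ N' := fun a ha => by
      have h1 := hBN a (hAB a ha)
      have h2 := (hℓ a (hAB a ha)).2.1
      have h3 := hN j hjK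
      omega
    have hlen : (B'.card : ℝ) ≤ ∑ a ∈ A, (ℓ a : ℝ) := by
      have h1 : B'.card ≤ ∑ a ∈ A, ℓ a := by
        refine (Finset.card_le_card hcov).trans (Finset.card_biUnion_le.trans (le_of_eq ?_))
        simp
      exact_mod_cast h1
    have hlen' : ∑ a ∈ A, (ℓ a : ℝ) ≤ N' := by exact_mod_cast sum_length_le hA hAN
    let w := packet c A ℓ
    -- The cross term is a sum of correlations of v with the blocks of w, each at most r * δ * ℓ a
    -- because the starting points avoid `bad`.
    have hvw : ‖∑ m ∈ Finset.range N', v m * conj (w m)‖ ≤ K * δ * N' := by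
      have h1 : ∑ m ∈ Finset.range N', v m * conj (w m) = ∑ a ∈ A, wordCorr c v a (ℓ a) := by
        simp only [w, conj_packet]
        rw [sum_mul_packet _ _ hAN]
        rfl
      rw [h1]
      refine (norm_sum_le _ _).trans ?_
      calc ∑ a ∈ A, ‖wordCorr c v a (ℓ a)‖ ≤ ∑ a ∈ A, r * δ * ℓ a := by
            refine Finset.sum_le_sum fun a ha => ?_
            by_contra hcon
            exact hAbad a ha ⟨ℓ a, (hℓ a (hAB a ha)).1, (hℓ a (hAB a ha)).2.1, not_le.1 hcon⟩
        _ = r * δ * ∑ a ∈ A, (ℓ a : ℝ) := by rw [Finset.mul_sum]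
        _ ≤ K * δ * N' := by gcongr
    refine ⟨fun m => v m + w m, ?_, ?_, ?_⟩
    · have h1 : ε * ∑ a ∈ A, (ℓ a : ℝ) ≤ (∑ m ∈ Finset.range N', G m * w m).re := by
        rw [sum_mul_packet _ _ hAN, Complex.re_sum, Finset.mul_sum]
        exact Finset.sum_le_sum fun a ha => (hℓ a (hAB a ha)).2.2
      have h2 : (B.card : ℝ) - K * (3 * δ * N') ≤ ∑ a ∈ A, (ℓ a : ℝ) := by
        have := mul_le_mul_of_nonneg_right hrK hδN
        linarith
      have h3 := mul_le_mul_of_nonneg_left h2 hε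
      simp only [mul_add, Finset.sum_add_distrib, Complex.add_re]
      push_cast
      linarith
    · have h1 : ∀ m, ‖v m + w m‖ ^ 2 = ‖v m‖ ^ 2 + ‖w m‖ ^ 2 + 2 * (v m * conj (w m)).re := by
        intro m
        simpa only [Complex.normSq_eq_norm_sq] using Complex.normSq_add (v m) (w m)
      simp only [h1, Finset.sum_add_distrib, ← Finset.mul_sum]
      rw [← Complex.re_sum]
      have h2 := (Complex.re_le_norm _).trans hvw
      have h3 : ∑ m ∈ Finset.range N', ‖w m‖ ^ 2 ≤ N' * C ^ 2 := by
        refine (Finset.sum_le_card_nsmul _ _ (C ^ 2) fun m _ => ?_).trans (by simp)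
        have := norm_packet_le hA hC m
        gcongr
      push_cast
      linarith
    · intro i hi
      have hij : i < j := by omega
      have h1 : ((r + 1 : ℕ) : ℝ) * δ = r * δ + δ := by push_cast; ring
      have h2 : countBelow (corrSet c (fun m => v m + w m) ((r + 1 : ℕ) * δ) (L i) (R i)) N
          ≤ countBelow (corrSet c v (r * δ) (L i) (R i)) N
            + countBelow (corrSet c w δ (L i) (R i)) N := by
        rw [h1]
        exact (countBelow_mono (corrSet_add_subset c v w _ _ _ _) N).trans
          (countBelow_union_le _ _ N)
      have h3 : (countBelow (corrSet c (fun m => v m + w m) ((r + 1 : ℕ) * δ) (L i) (R i)) N : ℝ)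
          ≤ countBelow (corrSet c v (r * δ) (L i) (R i)) N
            + countBelow (corrSet c w δ (L i) (R i)) N := by exact_mod_cast h2
      have h4 := hv3 i (by omega)
      have h5 : (countBelow (corrSet c w δ (L i) (R i)) N : ℝ) ≤ 3 * δ * N' :=
        countBelow_corrSet_packet_le hA hAN hδ (hLR i j hij hjK)
          (fun a ha => (hℓ a (hAB a ha)).1) (hcount i j hij hjK)
      push_cast at h3 ⊢
      linarith

/-- Write x for the contribution of one scale. The superposition pairs with G to at least K x, while
Cauchy–Schwarz bounds the square of the pairing by a multiple of K N' ^ 2; one factor K cancels. -/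
theorem card_bound_of_scales {c G : ℕ → ℂ} {C δ ε : ℝ} (hC : ∀ k, ‖c k‖ ≤ C) (hδ : 0 ≤ δ)
    (hε : 0 ≤ ε) {K N N' : ℕ} (hK : 0 < K) {L R : ℕ → ℕ} (hL : ∀ j < K, 1 ≤ L j)
    (hN : ∀ j < K, N + R j ≤ N')
    (hLR : ∀ i j, i < j → j < K → (R i : ℝ) ≤ δ * L j)
    (hcount : ∀ i j, i < j → j < K → ∀ n, L j ≤ n →
      (countBelow (corrSet c c δ (L i) (R i)) n : ℝ) ≤ δ * n)
    (hG : ∀ m, ‖G m‖ ≤ 1)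
    {B : Finset ℕ} (hBN : ∀ a ∈ B, a < N)
    (hB : ∀ a ∈ B, ∀ j < K, ∃ n, L j ≤ n ∧ n ≤ R j ∧
      ε * n ≤ (∑ k ∈ Finset.range n, G (a + k) * c k).re)
    (hcard : K * (3 * δ * N') ≤ B.card) :
    K * (ε * (B.card - K * (3 * δ * N'))) ^ 2 ≤ (C ^ 2 + 2 * (K * δ)) * N' ^ 2 := by
  obtain ⟨v, hv1, hv2, -⟩ := exists_superposition hC hδ hε hL hN hLR hcount hBN hB K le_rfl
  set x := ε * (B.card - K * (3 * δ * N'))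
  have hx : 0 ≤ x := mul_nonneg hε (sub_nonneg.2 hcard)
  have hKpos : (0 : ℝ) < K := by exact_mod_cast hK
  have h1 : (∑ m ∈ Finset.range N', G m * v m).re ≤ ∑ m ∈ Finset.range N', ‖v m‖ := by
    refine (Complex.re_le_norm _).trans ((norm_sum_le _ _).trans (Finset.sum_le_sum fun m _ => ?_))
    rw [norm_mul]
    exact mul_le_of_le_one_left (norm_nonneg _) (hG m)
  have h2 : (∑ m ∈ Finset.range N', ‖v m‖) ^ 2 ≤ N' * ∑ m ∈ Finset.range N', ‖v m‖ ^ 2 := by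
    have := sq_sum_le_card_mul_sum_sq (s := Finset.range N') (f := fun m => ‖v m‖)
    simpa using this
  have h3 : (K * x) ^ 2 ≤ (∑ m ∈ Finset.range N', ‖v m‖) ^ 2 :=
    pow_le_pow_left₀ (by positivity) (hv1.trans h1) 2
  have h4 : (N' : ℝ) * ∑ m ∈ Finset.range N', ‖v m‖ ^ 2
      ≤ N' * (K * ((C ^ 2 + 2 * (K * δ)) * N')) := by gcongr
  have h5 : (K : ℝ) * (K * x ^ 2) ≤ K * ((C ^ 2 + 2 * (K * δ)) * N' ^ 2) := by
    nlinarith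
  exact le_of_mul_le_mul_left h5 hKpos

end Combinatorics

/-! ### Small correlations imply convergence in every system. -/

section ReturnTimes

open scoped ComplexConjugate

/-- The initial words of `c`, once long enough, correlate with only few of their translates
in `c`. -/
def HasSmallCorrelations (c : ℕ → ℂ) : Prop :=
  ∀ δ : ℝ, 0 < δ → ∃ M : ℕ, ∀ R : ℕ, ∃ L₀ : ℕ, ∀ n, L₀ ≤ n →
    (countBelow (corrSet c c δ M R) n : ℝ) ≤ δ * n

theorem norm_le_of_re_mul_lt {z : ℂ} {e : ℝ} (h1 : (1 * z).re < e) (h2 : (-1 * z).re < e)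
    (h3 : (Complex.I * z).re < e) (h4 : (-Complex.I * z).re < e) : ‖z‖ ≤ 2 * e := by
  simp only [one_mul, neg_mul, Complex.neg_re, Complex.I_mul_re] at h1 h2 h3 h4
  have h5 : |z.re| ≤ e := abs_le.2 ⟨by linarith, by linarith⟩
  have h6 : |z.im| ≤ e := abs_le.2 ⟨by linarith, by linarith⟩
  linarith [Complex.norm_le_abs_re_add_abs_im z]

/-- A sequence of scales, each large in terms of the previous ones. -/
theorem exists_scales {c : ℕ → ℂ} (hc : HasSmallCorrelations c) {δ : ℝ} (hδ : 0 < δ)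
    (ρ : ℕ → ℕ) :
    ∃ L : ℕ → ℕ, (∀ j, 1 ≤ L j) ∧ (∀ i j, i < j → (ρ (L i) : ℝ) ≤ δ * L j) ∧
      ∀ i j, i < j → ∀ n, L j ≤ n →
        (countBelow (corrSet c c δ (L i) (ρ (L i))) n : ℝ) ≤ δ * n := by
  obtain ⟨M, hM⟩ := hc δ hδ
  choose L₀ hL₀ using hM
  -- The threshold M works for all R, so each upper end ρ l may be fixed after its scale l; the next
  -- scale dominates both ρ l / δ and L₀ (ρ l).
  let next : ℕ → ℕ := fun l => max l (max ⌈(ρ l : ℝ) / δ⌉₊ (L₀ (ρ l)))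
  let L : ℕ → ℕ := fun j => next^[j] (max 1 M)
  have hsucc : ∀ j, L (j + 1) = next (L j) := fun j => Function.iterate_succ_apply' _ _ _
  have hmono : Monotone L := monotone_nat_of_le_succ fun j => by
    rw [hsucc]
    exact le_max_left _ _
  have h0 : ∀ j, max 1 M ≤ L j := fun j => hmono (Nat.zero_le j)
  refine ⟨L, fun j => (le_max_left _ _).trans (h0 j), fun i j hij => ?_, fun i j hij n hn => ?_⟩
  · have h1 : ⌈(ρ (L i) : ℝ) / δ⌉₊ ≤ L j := by
      refine le_trans ?_ (hmono hij)
      rw [hsucc]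
      exact (le_max_left _ _).trans (le_max_right _ _)
    have h2 := Nat.ceil_le.1 h1
    rwa [div_le_iff₀ hδ, mul_comm] at h2
  · have h1 : L₀ (ρ (L i)) ≤ L j := by
      refine le_trans ?_ (hmono hij)
      rw [hsucc]
      exact (le_max_right _ _).trans (le_max_right _ _)
    refine le_trans ?_ (hL₀ (ρ (L i)) n (h1.trans hn))
    exact_mod_cast countBelow_mono
      (corrSet_mono c c δ ((le_max_right 1 M).trans (h0 i)) le_rfl) n

variable {Y : Type*} [MeasurableSpace Y] {ν : Measure Y}

/-- In a measure preserving system some orbit segment visits a set at least as often as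
expected. -/
theorem exists_card_visits_ge [IsProbabilityMeasure ν] {S : Y → Y} (hS : MeasurePreserving S ν ν)
    {E : Set Y} (hE : MeasurableSet E) (N : ℕ) :
    ∃ y, ∃ B : Finset ℕ, (∀ a ∈ B, a < N ∧ S^[a] y ∈ E) ∧ N * ν.real E ≤ B.card := by
  classical
  let φ : ℕ → Y → ℝ := fun n => (S^[n] ⁻¹' E).indicator 1
  have hm : ∀ n, MeasurableSet (S^[n] ⁻¹' E) := fun n => (hS.iterate n).measurable hE
  have hφ : ∀ n, Integrable (φ n) ν := fun n => (integrable_const (1 : ℝ)).indicator (hm n)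
  obtain ⟨y, hy⟩ := exists_integral_le (integrable_finsetSum (Finset.range N) fun n _ => hφ n)
  refine ⟨y, (Finset.range N).filter fun n => S^[n] y ∈ E, fun a ha => ?_, ?_⟩
  · simpa using ha
  · have h1 : ∀ n, ∫ y, φ n y ∂ν = ν.real E := fun n => by
      rw [integral_indicator_one (hm n), measureReal_def,
        (hS.iterate n).measure_preimage hE.nullMeasurableSet, measureReal_def]
    rw [integral_finsetSum _ fun n _ => hφ n] at hy
    simp only [h1, Finset.sum_const, Finset.card_range, nsmul_eq_mul] at hy
    refine hy.trans (le_of_eq ?_)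
    rw [Finset.card_filter]
    push_cast
    refine Finset.sum_congr rfl fun n _ => ?_
    by_cases h : S^[n] y ∈ E <;> simp [φ, h]

theorem ae_eventually_re_sum_lt [IsProbabilityMeasure ν] {S : Y → Y} (hS : MeasurePreserving S ν ν)
    {g : Y → ℂ} (hg : Measurable g) (hg1 : ∀ y, ‖g y‖ ≤ 1) {c : ℕ → ℂ} {C : ℝ}
    (hC : ∀ k, ‖c k‖ ≤ C) (hc : HasSmallCorrelations c) {ε : ℝ} (hε : 0 < ε) :
    ∀ᵐ y ∂ν, ∀ᶠ n : ℕ in atTop, (∑ k ∈ Finset.range n, g (S^[k] y) * c k).re < ε * n := by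
  let s : ℕ → Y → ℝ := fun n y => (∑ k ∈ Finset.range n, g (S^[k] y) * c k).re
  have hs : ∀ n, Measurable (s n) := fun n => Complex.measurable_re.comp
    (Finset.measurable_fun_sum _ fun k _ =>
      (hg.comp (hS.iterate k).measurable).mul_const _)
  let F : ℕ → ℕ → Set Y := fun L R => {y | ∃ n, L ≤ n ∧ n ≤ R ∧ ε * n ≤ s n y}
  have hF : ∀ L R, MeasurableSet (F L R) := by
    intro L R
    have h1 : F L R = ⋃ n, {y | L ≤ n ∧ n ≤ R ∧ ε * n ≤ s n y} := by
      ext y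
      simp [F]
    rw [h1]
    exact MeasurableSet.iUnion fun n => (MeasurableSet.const _).inter
      ((MeasurableSet.const _).inter (measurableSet_le measurable_const (hs n)))
  let E : Set Y := ⋂ L, ⋃ R, F L R
  have hE : MeasurableSet E := MeasurableSet.iInter fun L => MeasurableSet.iUnion fun R => hF L R
  suffices hE0 : ν.real E = 0 by
    have hE0' : ν E = 0 := by
      rwa [measureReal_def, ENNReal.toReal_eq_zero_iff, or_iff_left (measure_ne_top ν E)] at hE0
    filter_upwards [measure_eq_zero_iff_ae_notMem.1 hE0'] with y hy
    by_contra hcon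
    refine hy (Set.mem_iInter.2 fun L => ?_)
    rw [Filter.not_eventually] at hcon
    obtain ⟨n, hLn, hn⟩ := (Filter.frequently_atTop.1 hcon) L
    exact Set.mem_iUnion.2 ⟨n, n, hLn, le_rfl, not_lt.1 hn⟩
  by_contra hne
  set β := ν.real E
  have hβ : 0 < β := lt_of_le_of_ne measureReal_nonneg (Ne.symm hne)
  have hβ1 : β ≤ 1 := measureReal_le_one
  -- K is chosen so that K * (ε * β / 4) ^ 2 exceeds 4 * (C ^ 2 + 1), the 4 coming from N' = 2 * N
  -- squared.
  obtain ⟨K, hK⟩ := exists_nat_gt (4 * (C ^ 2 + 1) / (ε * β / 4) ^ 2)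
  have hKpos : (0 : ℝ) < K := lt_of_le_of_lt (by positivity) hK
  rw [div_lt_iff₀ (by positivity)] at hK
  have hK0 : 0 < K := by exact_mod_cast hKpos
  -- For fixed L the sets F L R increase with R and cover E. The K losses of β / (2 * K) add up to β
  -- / 2.
  have hρ : ∀ L, ∃ R, ν.real (E \ F L R) ≤ β / (2 * K) := by
    intro L
    have hanti : Antitone fun R => E \ F L R := fun R R' h =>
      Set.sdiff_subset_sdiff_right fun y ⟨n, h1, h2, h3⟩ => ⟨n, h1, h2.trans h, h3⟩
    have hlim := tendsto_measure_iInter_atTop (μ := ν) (s := fun R => E \ F L R)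
      (fun R => (hE.diff (hF L R)).nullMeasurableSet) hanti ⟨0, measure_ne_top _ _⟩
    have hemp : ⋂ R, E \ F L R = ∅ := by
      refine Set.eq_empty_iff_forall_notMem.2 fun y hy => ?_
      rw [Set.mem_iInter] at hy
      obtain ⟨R, hR⟩ := Set.mem_iUnion.1 (Set.mem_iInter.1 (hy 0).1 L)
      exact (hy R).2 hR
    rw [hemp, measure_empty] at hlim
    have hlim' := (ENNReal.tendsto_toReal ENNReal.zero_ne_top).comp hlim
    obtain ⟨R, hR⟩ := (hlim'.eventually_lt_const
      (show (0 : ℝ≥0∞).toReal < β / (2 * K) by simp; positivity)).exists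
    exact ⟨R, hR.le⟩
  choose ρ hρ using hρ
  -- With N' = 2 * N the loss K * (3 * δ * N') equals N * β / 4, half of the N * β / 2 visits found
  -- below.
  set δ := β / (24 * K)
  have hδ : 0 < δ := by positivity
  have hKδ : K * δ = β / 24 := by simp only [δ]; field_simp
  obtain ⟨L, hL1, hL2, hL3⟩ := exists_scales hc hδ ρ
  let E' : Set Y := E ∩ ⋂ j ∈ Finset.range K, F (L j) (ρ (L j))
  have hE' : MeasurableSet E' :=
    hE.inter (Finset.measurableSet_biInter _ fun j _ => hF _ _)
  have hE'β : β / 2 ≤ ν.real E' := by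
    have h1 : E ⊆ E' ∪ ⋃ j ∈ Finset.range K, E \ F (L j) (ρ (L j)) := by
      intro y hy
      by_cases h : ∀ j ∈ Finset.range K, y ∈ F (L j) (ρ (L j))
      · exact Or.inl ⟨hy, Set.mem_iInter₂.2 h⟩
      · push Not at h
        obtain ⟨j, hj, hj'⟩ := h
        exact Or.inr (Set.mem_iUnion₂.2 ⟨j, hj, hy, hj'⟩)
    have h2 : β ≤ ν.real E' + ∑ j ∈ Finset.range K, ν.real (E \ F (L j) (ρ (L j))) :=
      (measureReal_mono h1).trans ((measureReal_union_le _ _).trans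
        (add_le_add_right (measureReal_biUnion_finset_le _ _) _))
    have h3 : ∑ j ∈ Finset.range K, ν.real (E \ F (L j) (ρ (L j))) ≤ β / 2 := by
      refine (Finset.sum_le_card_nsmul _ _ _ fun j _ => hρ (L j)).trans (le_of_eq ?_)
      rw [Finset.card_range, nsmul_eq_mul]
      field_simp
    linarith
  -- N dominates every ρ (L j), so blocks starting below N end by 2 * N; the summand 1 keeps N
  -- positive.
  let N := 1 + ∑ j ∈ Finset.range K, ρ (L j)
  have hNρ : ∀ j < K, ρ (L j) ≤ N := fun j hj =>
    (Finset.single_le_sum (f := fun j => ρ (L j)) (fun _ _ => Nat.zero_le _)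
      (Finset.mem_range.2 hj)).trans (Nat.le_add_left _ _)
  have hNpos : (0 : ℝ) < N := by
    have : 0 < N := by omega
    exact_mod_cast this
  obtain ⟨y, B, hB, hBcard⟩ := exists_card_visits_ge hS hE' N
  have hBcard' : N * (β / 2) ≤ (B.card : ℝ) :=
    (mul_le_mul_of_nonneg_left hE'β hNpos.le).trans hBcard
  have e1 : K * (3 * δ * ((2 * N : ℕ) : ℝ)) = N * (β / 4) := by
    push_cast
    linear_combination (6 * N : ℝ) * hKδ
  have key := card_bound_of_scales (c := c) (G := fun m => g (S^[m] y)) (C := C) (δ := δ) (ε := ε)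
    (K := K) (N := N) (N' := 2 * N) (L := L) (R := fun j => ρ (L j)) hC hδ.le hε.le hK0
    (fun j _ => hL1 j) (fun j hj => by have := hNρ j hj; omega) (fun i j hij _ => hL2 i j hij)
    (fun i j hij _ => hL3 i j hij) (fun m => hg1 _) (B := B) (fun a ha => (hB a ha).1)
    (fun a ha j hj => by
      obtain ⟨n, h1, h2, h3⟩ := Set.mem_iInter₂.1 (hB a ha).2.2 j (Finset.mem_range.2 hj)
      refine ⟨n, h1, h2, h3.trans (le_of_eq ?_)⟩
      simp only [s, ← Function.iterate_add_apply, add_comm])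
    (by rw [e1]; nlinarith)
  rw [e1, hKδ] at key
  have h1 : ε * (N * (β / 4)) ≤ ε * (B.card - N * (β / 4)) := by
    gcongr
    linarith
  have h2 : (ε * (N * (β / 4))) ^ 2 ≤ (ε * (B.card - N * (β / 4))) ^ 2 :=
    pow_le_pow_left₀ (by positivity) h1 2
  have h3 : (K * (ε * β / 4) ^ 2) * (N : ℝ) ^ 2 ≤ (4 * (C ^ 2 + 1)) * (N : ℝ) ^ 2 := by
    have h4 := mul_le_mul_of_nonneg_left h2 hKpos.le
    push_cast at key
    have h5 : (C ^ 2 + 2 * (β / 24)) * (2 * (N : ℝ)) ^ 2 ≤ (C ^ 2 + 1) * (2 * (N : ℝ)) ^ 2 := by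
      gcongr
      linarith
    linarith
  exact absurd (le_of_mul_le_mul_right h3 (by positivity)) (not_le.2 hK)

/-- Multiplying g by 1, -1, i or -i keeps it in the unit ball, so four one-sided bounds on real
parts control the modulus. -/
theorem ae_tendsto_average_of_norm_le_one [IsProbabilityMeasure ν] {S : Y → Y}
    (hS : MeasurePreserving S ν ν)
    {g : Y → ℂ} (hg : Measurable g) (hg1 : ∀ y, ‖g y‖ ≤ 1) {c : ℕ → ℂ} {C : ℝ}
    (hC : ∀ k, ‖c k‖ ≤ C) (hc : HasSmallCorrelations c) :
    ∀ᵐ y ∂ν, Tendsto (fun N : ℕ => (1 / (N : ℂ)) * ∑ k ∈ Finset.range N, c k * g (S^[k] y))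
      atTop (𝓝 0) := by
  have key : ∀ u : ℂ, ‖u‖ ≤ 1 → ∀ᵐ y ∂ν, ∀ q : ℕ, ∀ᶠ n : ℕ in atTop,
      (u * ∑ k ∈ Finset.range n, c k * g (S^[k] y)).re < 1 / ((q : ℝ) + 1) * n := by
    intro u hu
    rw [ae_all_iff]
    intro q
    have h1 := ae_eventually_re_sum_lt hS (hg.const_mul u) (fun y => by
      rw [norm_mul]
      exact mul_le_one₀ hu (norm_nonneg _) (hg1 y)) hC hc (Nat.one_div_pos_of_nat (n := q) (α := ℝ))
    filter_upwards [h1] with y hy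
    filter_upwards [hy] with n hn
    rw [Finset.mul_sum]
    simpa only [mul_assoc, mul_comm (g _)] using hn
  filter_upwards [key 1 (by simp), key (-1) (by simp), key Complex.I (by simp),
    key (-Complex.I) (by simp)] with y h1 h2 h3 h4
  rw [Metric.tendsto_nhds]
  intro e he
  obtain ⟨q, hq⟩ := exists_nat_one_div_lt (half_pos he)
  filter_upwards [h1 q, h2 q, h3 q, h4 q, eventually_gt_atTop 0] with n h1 h2 h3 h4 hn
  have h5 := norm_le_of_re_mul_lt h1 h2 h3 h4
  have hn' : (0 : ℝ) < n := by exact_mod_cast hn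
  rw [dist_zero_right, norm_mul, norm_div, norm_one, Complex.norm_natCast, one_div,
    inv_mul_lt_iff₀ hn']
  nlinarith

/-- The bound is needed everywhere, since the counting argument evaluates g along one particular
orbit selected by averaging. -/
theorem MeasureTheory.MemLp.exists_measurable_norm_le_one {g : Y → ℂ} (hg : MemLp g ∞ ν) :
    ∃ D : ℝ, ∃ g' : Y → ℂ, Measurable g' ∧ (∀ y, ‖g' y‖ ≤ 1) ∧ g =ᵐ[ν] fun y => D * g' y := by
  let g₀ := hg.1.mk g
  have hg₀ : Measurable g₀ := hg.1.stronglyMeasurable_mk.measurable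
  let D : ℝ := max 1 (eLpNorm g ∞ ν).toReal
  have hD : 0 < D := lt_of_lt_of_le one_pos (le_max_left _ _)
  have hgD : ∀ᵐ y ∂ν, ‖g y‖ ≤ D := by
    have h1 := hg.2
    rw [eLpNorm_exponent_top] at h1
    filter_upwards [ae_le_eLpNormEssSup (f := g) (μ := ν)] with y hy
    refine le_trans ?_ (le_max_right _ _)
    rw [eLpNorm_exponent_top]
    have h2 := ENNReal.toReal_mono h1.ne hy
    simpa using h2
  have hms : MeasurableSet {y | ‖g₀ y‖ ≤ D} := measurableSet_le hg₀.norm measurable_const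
  refine ⟨D, {y | ‖g₀ y‖ ≤ D}.indicator fun y => (D : ℂ)⁻¹ * g₀ y,
    (hg₀.const_mul _).indicator hms, fun y => ?_, ?_⟩
  · by_cases hy : ‖g₀ y‖ ≤ D
    · rw [Set.indicator_of_mem (show y ∈ {y | ‖g₀ y‖ ≤ D} from hy), norm_mul, norm_inv,
        Complex.norm_real, Real.norm_of_nonneg hD.le, inv_mul_le_iff₀ hD, mul_one]
      exact hy
    · rw [Set.indicator_of_notMem (show y ∉ {y | ‖g₀ y‖ ≤ D} from hy)]
      simp
  · filter_upwards [hgD, hg.1.ae_eq_mk] with y h1 h2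
    have h3 : y ∈ {y | ‖g₀ y‖ ≤ D} := by
      change ‖hg.1.mk g y‖ ≤ D
      rwa [← h2]
    rw [Set.indicator_of_mem h3, ← mul_assoc,
      mul_inv_cancel₀ (Complex.ofReal_ne_zero.2 hD.ne'), one_mul]
    exact h2

theorem ae_tendsto_average [IsProbabilityMeasure ν] {S : Y → Y} (hS : MeasurePreserving S ν ν)
    {g : Y → ℂ} (hg : MemLp g ∞ ν) {c : ℕ → ℂ} {C : ℝ}
    (hC : ∀ k, ‖c k‖ ≤ C) (hc : HasSmallCorrelations c) :
    ∀ᵐ y ∂ν, Tendsto (fun N : ℕ => (1 / (N : ℂ)) * ∑ k ∈ Finset.range N, c k * g (S^[k] y))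
      atTop (𝓝 0) := by
  obtain ⟨D, g', hg', hg1, hgg'⟩ := hg.exists_measurable_norm_le_one
  have h1 : ∀ᵐ y ∂ν, ∀ n : ℕ, g (S^[n] y) = D * g' (S^[n] y) :=
    ae_all_iff.2 fun n => (hS.iterate n).quasiMeasurePreserving.ae hgg'
  filter_upwards [h1, ae_tendsto_average_of_norm_le_one hS hg' hg1 hC hc] with y h2 h3
  have h4 := h3.const_mul (D : ℂ)
  rw [mul_zero] at h4
  refine h4.congr fun N => ?_
  rw [mul_left_comm, Finset.mul_sum]
  congr 1
  refine Finset.sum_congr rfl fun k _ => ?_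
  rw [h2 k]
  ring

end ReturnTimes

/-! ### Almost every orbit has small correlations. -/

section Generic

open scoped ComplexConjugate

theorem wordCorr_congr {c c' : ℕ → ℂ} (v : ℕ → ℂ) (m : ℕ) {n : ℕ} (h : ∀ k < n, c k = c' k) :
    wordCorr c v m n = wordCorr c' v m n :=
  Finset.sum_congr rfl fun k hk => by rw [h k (Finset.mem_range.1 hk)]

theorem corrSet_congr {c c' : ℕ → ℂ} (v : ℕ → ℂ) (δ : ℝ) (L : ℕ) {R : ℕ}
    (h : ∀ k < R, c k = c' k) : corrSet c v δ L R = corrSet c' v δ L R := by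
  ext m
  refine exists_congr fun n => and_congr_right fun _ => and_congr_right fun hn => ?_
  rw [wordCorr_congr v m fun k hk => h k (hk.trans_le hn)]

theorem corrSet_anti (c v : ℕ → ℂ) {δ δ' : ℝ} (h : δ ≤ δ') (L R : ℕ) :
    corrSet c v δ' L R ⊆ corrSet c v δ L R :=
  fun _ ⟨n, h1, h2, h3⟩ => ⟨n, h1, h2, lt_of_le_of_lt (by gcongr) h3⟩

variable {X : Type*} [MeasurableSpace X] {μ : Measure X} {T : X → X}

/-- The points whose orbit under `f` correlates with an initial word of `c` whose length lies in
`[L, R]`. -/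
def corrPoints (T : X → X) (f : X → ℂ) (c : ℕ → ℂ) (δ : ℝ) (L R : ℕ) : Set X :=
  {ξ | 0 ∈ corrSet c (fun n => f (T^[n] ξ)) δ L R}

theorem wordCorr_orbit {X : Type*} {T : X → X} (f : X → ℂ) (c : ℕ → ℂ) (x : X) (d n : ℕ) :
    wordCorr c (fun n => f (T^[n] (T^[d] x))) 0 n = wordCorr c (fun n => f (T^[n] x)) d n :=
  Finset.sum_congr rfl fun k _ => by
    simp only [zero_add]
    rw [← Function.iterate_add_apply, add_comm]

theorem iterate_mem_corrPoints {X : Type*} {T : X → X} (f : X → ℂ) (c : ℕ → ℂ) (δ : ℝ) (L R : ℕ) (x : X) (d : ℕ) :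
    T^[d] x ∈ corrPoints T f c δ L R ↔ d ∈ corrSet c (fun n => f (T^[n] x)) δ L R := by
  refine exists_congr fun n => ?_
  rw [wordCorr_orbit]

theorem measurableSet_corrPoints (hT : Measurable T) {f : X → ℂ} (hf : Measurable f) (c : ℕ → ℂ)
    (δ : ℝ) (L R : ℕ) : MeasurableSet (corrPoints T f c δ L R) := by
  have h1 : corrPoints T f c δ L R = ⋃ n, {ξ | L ≤ n ∧ n ≤ R ∧
      δ * n < ‖wordCorr c (fun n => f (T^[n] ξ)) 0 n‖} := by
    ext ξ
    simp [corrPoints, corrSet]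
  rw [h1]
  refine MeasurableSet.iUnion fun n => (MeasurableSet.const _).inter
    ((MeasurableSet.const _).inter (measurableSet_lt measurable_const (Measurable.norm ?_)))
  refine Finset.measurable_fun_sum _ fun k _ => Measurable.mul_const ?_ _
  exact hf.comp (hT.iterate _)

/-- Along almost every orbit of an ergodic map, a set is not visited more often than expected. -/
theorem Ergodic.ae_eventually_countBelow_le [IsProbabilityMeasure μ] (hT : Ergodic T μ) {A : Set X}
    (hA : MeasurableSet A) {δ : ℝ} (hδ : μ.real A < δ) :
    ∀ᵐ x ∂μ, ∀ᶠ n : ℕ in atTop, (countBelow {d | T^[d] x ∈ A} n : ℝ) ≤ δ * n := by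
  classical
  let F : X → ℝ := fun x => A.indicator 1 x - μ.real A
  have hFm : Measurable F := (measurable_one.indicator hA).sub_const _
  have hF0 : ∫ x, F x ∂μ = 0 := by
    have h1 : Integrable (A.indicator (1 : X → ℝ)) μ := (integrable_const (1 : ℝ)).indicator hA
    rw [integral_sub h1 (integrable_const _), integral_indicator_one hA]
    simp
  have hFb : ∀ x, |F x| ≤ 2 := fun x => by
    have h1 : μ.real A ≤ 1 := measureReal_le_one
    have h2 : 0 ≤ μ.real A := measureReal_nonneg
    by_cases h : x ∈ A <;> simp only [F, h, Set.indicator_of_mem, Set.indicator_of_notMem,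
      not_false_eq_true, Pi.one_apply, abs_le] <;> constructor <;> linarith
  -- By ergodicity an invariant set is null or of full measure, and F has mean zero.
  have key := ae_eventually_birkhoffSum_lt hT.toMeasurePreserving hFm hFb (fun E hE hinv => by
    rcases hT.ae_empty_or_univ hE hinv with h | h
    · rw [setIntegral_congr_set h]
      simp
    · rw [setIntegral_congr_set h, setIntegral_univ, hF0]) (sub_pos.2 hδ)
  filter_upwards [key] with x hx
  filter_upwards [hx] with n hn
  have h1 : birkhoffSum T F n x = countBelow {d | T^[d] x ∈ A} n - n * μ.real A := by
    simp only [birkhoffSum, F, Finset.sum_sub_distrib, Finset.sum_const, Finset.card_range,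
      nsmul_eq_mul, countBelow, Finset.card_filter]
    push_cast
    congr 1
  rw [h1] at hn
  linarith

/-- If `f ⊗ f̄` has zero integral over invariant sets, then almost all pairs of orbits are
asymptotically orthogonal. -/
theorem ae_ae_eventually_norm_wordCorr_le [IsProbabilityMeasure μ] (hT : MeasurePreserving T μ μ)
    {f : X → ℂ} (hf : Measurable f) {C : ℝ} (hC : ∀ x, ‖f x‖ ≤ C)
    (hinv : ∀ E : Set (X × X), MeasurableSet E → Prod.map T T ⁻¹' E = E →
      ∫ z in E, conj (f z.1) * f z.2 ∂(μ.prod μ) = 0) :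
    ∀ᵐ x ∂μ, ∀ᵐ ξ ∂μ, ∀ q : ℕ, ∀ᶠ n : ℕ in atTop,
      ‖wordCorr (fun n => f (T^[n] x)) (fun n => f (T^[n] ξ)) 0 n‖ ≤ 1 / ((q : ℝ) + 1) * n := by
  let φ : X × X → ℂ := fun z => conj (f z.1) * f z.2
  have hφ : Measurable φ := (RCLike.continuous_conj.measurable.comp
    (hf.comp measurable_fst)).mul (hf.comp measurable_snd)
  have hφb : ∀ z, ‖φ z‖ ≤ C * C := fun z => by
    rw [norm_mul, RCLike.norm_conj]
    exact mul_le_mul (hC _) (hC _) (norm_nonneg _) ((norm_nonneg _).trans (hC z.1))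
  have hφi : Integrable φ (μ.prod μ) :=
    Integrable.of_bound hφ.aestronglyMeasurable _ (ae_of_all _ hφb)
  have hTT : MeasurePreserving (Prod.map T T) (μ.prod μ) (μ.prod μ) := hT.prod hT
  have key : ∀ u : ℂ, ‖u‖ ≤ 1 → ∀ᵐ z ∂(μ.prod μ), ∀ q : ℕ, ∀ᶠ n : ℕ in atTop,
      (u * wordCorr (fun n => f (T^[n] z.1)) (fun n => f (T^[n] z.2)) 0 n).re
        < 1 / (2 * ((q : ℝ) + 1)) * n := by
    intro u hu
    rw [ae_all_iff]
    intro q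
    have h1 := ae_eventually_birkhoffSum_lt hTT (F := fun z => (u * φ z).re) (C := C * C)
      (Complex.measurable_re.comp (hφ.const_mul u)) (fun z => by
        refine (Complex.abs_re_le_norm _).trans ?_
        rw [norm_mul]
        exact (mul_le_of_le_one_left (norm_nonneg _) hu).trans (hφb z)) (fun E hE hEinv => by
        have h2 := integral_re (𝕜 := ℂ) (hφi.const_mul u).integrableOn (μ := (μ.prod μ).restrict E)
        rw [integral_const_mul, hinv E hE hEinv, mul_zero] at h2
        exact le_of_eq (h2.trans (by simp)))
      (show (0 : ℝ) < 1 / (2 * ((q : ℝ) + 1)) by positivity)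
    filter_upwards [h1] with z hz
    filter_upwards [hz] with n hn
    refine lt_of_eq_of_lt ?_ hn
    rw [wordCorr, Finset.mul_sum, Complex.re_sum]
    refine Finset.sum_congr rfl fun k _ => ?_
    simp only [zero_add, Prod.map_iterate, Prod.map_fst, Prod.map_snd, φ]
    rw [mul_comm (f _)]
  have h5 : ∀ᵐ z ∂(μ.prod μ), ∀ q : ℕ, ∀ᶠ n : ℕ in atTop,
      ‖wordCorr (fun n => f (T^[n] z.1)) (fun n => f (T^[n] z.2)) 0 n‖
        ≤ 1 / ((q : ℝ) + 1) * n := by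
    filter_upwards [key 1 (by simp), key (-1) (by simp), key Complex.I (by simp),
      key (-Complex.I) (by simp)] with z h1 h2 h3 h4 q
    filter_upwards [h1 q, h2 q, h3 q, h4 q] with n h1 h2 h3 h4
    refine (norm_le_of_re_mul_lt h1 h2 h3 h4).trans (le_of_eq ?_)
    field_simp
  exact Measure.ae_ae_of_ae_prod h5

/-- An Egorov-type argument: the points correlating at some length at least M form sets decreasing
to a null set. They contain the correlation points for every R at once, so M does not depend on R.
-/
theorem exists_measureReal_corrPoints_lt [IsProbabilityMeasure μ] (hT : Measurable T) {f : X → ℂ}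
    (hf : Measurable f) (c : ℕ → ℂ) {δ : ℝ} (hδ : 0 < δ)
    (h : ∀ᵐ ξ ∂μ, ∀ᶠ n : ℕ in atTop, ‖wordCorr c (fun n => f (T^[n] ξ)) 0 n‖ ≤ δ * n) :
    ∃ M, ∀ R, μ.real (corrPoints T f c δ M R) < δ := by
  let A : ℕ → Set X := fun M => ⋃ R, corrPoints T f c δ M R
  have hA : ∀ M, MeasurableSet (A M) := fun M =>
    MeasurableSet.iUnion fun R => measurableSet_corrPoints hT hf c δ M R
  have hanti : Antitone A := fun M M' hM =>
    Set.iUnion_mono fun R ξ hξ => corrSet_mono c _ δ hM le_rfl hξ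
  have hlim := tendsto_measure_iInter_atTop (μ := μ) (fun M => (hA M).nullMeasurableSet) hanti
    ⟨0, measure_ne_top _ _⟩
  have hnull : μ (⋂ M, A M) = 0 := by
    rw [measure_eq_zero_iff_ae_notMem]
    filter_upwards [h] with ξ hξ hmem
    obtain ⟨M, hM⟩ := eventually_atTop.1 hξ
    obtain ⟨R, n, h1, -, h3⟩ := Set.mem_iUnion.1 (Set.mem_iInter.1 hmem M)
    exact absurd (hM n h1) (not_le.2 h3)
  rw [hnull] at hlim
  have hlim' := (ENNReal.tendsto_toReal ENNReal.zero_ne_top).comp hlim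
  obtain ⟨M, hM⟩ := (hlim'.eventually_lt_const (show (0 : ℝ≥0∞).toReal < δ by simpa)).exists
  exact ⟨M, fun R => lt_of_le_of_lt (measureReal_mono (Set.subset_iUnion _ R)) hM⟩

/-- Almost every orbit of a finite-valued function `f`, such that `f ⊗ f̄` has zero integral over
invariant sets, has small correlations. -/
theorem ae_hasSmallCorrelations [IsProbabilityMeasure μ] (hT : Ergodic T μ)
    {f : X → ℂ} (hf : Measurable f) (hfin : (Set.range f).Finite) {C : ℝ} (hC : ∀ x, ‖f x‖ ≤ C)
    (hinv : ∀ E : Set (X × X), MeasurableSet E → Prod.map T T ⁻¹' E = E →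
      ∫ z in E, conj (f z.1) * f z.2 ∂(μ.prod μ) = 0) :
    ∀ᵐ x ∂μ, HasSmallCorrelations fun n => f (T^[n] x) := by
  have : Finite (Set.range f) := hfin.to_subtype
  -- The exceptional sets depend on x only through the first R values of f along its orbit. Since f
  -- has finitely many values there are countably many choices of q, M, R and word, hence one null
  -- set for all. The padding by zero is never read.
  let ext : (R : ℕ) → (Fin R → Set.range f) → ℕ → ℂ := fun R w n =>
    if h : n < R then (w ⟨n, h⟩ : ℂ) else 0
  have hfreq : ∀ᵐ x ∂μ, ∀ q M R : ℕ, ∀ w : Fin R → Set.range f,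
      μ.real (corrPoints T f (ext R w) (1 / ((q : ℝ) + 1)) M R) < 1 / ((q : ℝ) + 1) →
      ∀ᶠ n : ℕ in atTop,
        (countBelow {d | T^[d] x ∈ corrPoints T f (ext R w) (1 / ((q : ℝ) + 1)) M R} n : ℝ)
          ≤ 1 / ((q : ℝ) + 1) * n := by
    simp only [ae_all_iff]
    intro q M R w hlt
    exact hT.ae_eventually_countBelow_le
      (measurableSet_corrPoints hT.measurable hf _ _ _ _) hlt
  filter_upwards [hfreq, ae_ae_eventually_norm_wordCorr_le hT.toMeasurePreserving hf hC hinv]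
    with x hx1 hx2 δ hδ
  obtain ⟨q, hq⟩ := exists_nat_one_div_lt hδ
  set δ' : ℝ := 1 / ((q : ℝ) + 1)
  have hδ' : 0 < δ' := by positivity
  obtain ⟨M, hM⟩ := exists_measureReal_corrPoints_lt hT.measurable hf (fun n => f (T^[n] x)) hδ'
    (by filter_upwards [hx2] with ξ hξ using hξ q)
  refine ⟨M, fun R => ?_⟩
  let w : Fin R → Set.range f := fun i => ⟨f (T^[i] x), Set.mem_range_self _⟩
  have hw : ∀ k < R, f (T^[k] x) = ext R w k := fun k hk => by simp [ext, w, hk]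
  have hset : ∀ v, corrSet (fun n => f (T^[n] x)) v δ' M R = corrSet (ext R w) v δ' M R :=
    fun v => corrSet_congr v δ' M hw
  have hpts : corrPoints T f (fun n => f (T^[n] x)) δ' M R = corrPoints T f (ext R w) δ' M R := by
    simp only [corrPoints, hset]
  obtain ⟨L₀, hL₀⟩ := eventually_atTop.1 (hx1 q M R w (by rw [← hpts]; exact hM R))
  refine ⟨L₀, fun n hn => ?_⟩
  have h1 := hL₀ n hn
  have h2 : {d | T^[d] x ∈ corrPoints T f (ext R w) δ' M R}
      = corrSet (fun n => f (T^[n] x)) (fun n => f (T^[n] x)) δ' M R := by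
    ext d
    rw [hset]
    exact iterate_mem_corrPoints f _ δ' M R x d
  rw [h2] at h1
  have h3 : (countBelow (corrSet (fun n => f (T^[n] x)) (fun n => f (T^[n] x)) δ M R) n : ℝ)
      ≤ countBelow (corrSet (fun n => f (T^[n] x)) (fun n => f (T^[n] x)) δ' M R) n := by
    exact_mod_cast countBelow_mono (corrSet_anti _ _ hq.le M R) n
  have h4 : δ' * n ≤ δ * n := by gcongr
  linarith

end Generic

/-! ### The return times theorem for functions orthogonal to the Kronecker factor. -/

theorem mainTheorem3 {X : Type*} [MeasurableSpace X] (μ : Measure X)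
    [IsProbabilityMeasure μ] (T : X → X) (hT : Ergodic T μ) (hTinv : IsAEInvertible T μ)
    (f : X → ℂ) (hf : MemLp f ∞ μ) (hfsimple : (Set.range f).Finite)
    (hfK : (hf.mono_exponent (p := 2) le_top).toLp f ∈
      (kroneckerFactor hT.toMeasurePreserving)ᗮ) :
    ∃ X' : Set X, MeasurableSet X' ∧ μ X' = 1 ∧
      ∀ (Y : Type*) [MeasurableSpace Y] (ν : Measure Y) [IsProbabilityMeasure ν]
        (S : Y → Y), Ergodic S ν → IsAEInvertible S ν →
        ∀ g : Y → ℂ, MemLp g ∞ ν →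
          ∀ x ∈ X', ∀ᵐ y ∂ν,
            Tendsto
              (fun N : ℕ => (1 / (N : ℂ)) * ∑ n ∈ Finset.Icc 1 N, f (T^[n] x) * g (S^[n] y))
              atTop (𝓝 0) := by
  let f₀ := hf.1.mk f
  have hf₀ : Measurable f₀ := hf.1.stronglyMeasurable_mk.measurable
  have hms : MeasurableSet (f₀ ⁻¹' Set.range f) := hf₀ hfsimple.measurableSet
  -- Truncating the measurable version to the range of f restores finitely many values and changes
  -- it only on a null set.
  let f₁ : X → ℂ := (f₀ ⁻¹' Set.range f).indicator f₀
  have hf₁ : Measurable f₁ := hf₀.indicator hms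
  have hfin : (Set.range f₁).Finite := by
    refine (hfsimple.insert 0).subset ?_
    rintro _ ⟨x, rfl⟩
    by_cases h : x ∈ f₀ ⁻¹' Set.range f
    · exact Or.inr (by
        have h1 : f₁ x = f₀ x := Set.indicator_of_mem h f₀
        rw [h1]
        exact h)
    · exact Or.inl (Set.indicator_of_notMem h _)
  obtain ⟨C, hC⟩ := hfin.isBounded.exists_norm_le
  have hC' : ∀ x, ‖f₁ x‖ ≤ C := fun x => hC _ (Set.mem_range_self x)
  have hff₁ : f =ᵐ[μ] f₁ := by
    filter_upwards [hf.1.ae_eq_mk] with x hx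
    have h : x ∈ f₀ ⁻¹' Set.range f := ⟨x, hx⟩
    simp only [f₁, Set.indicator_of_mem h]
    exact hx
  have hinv : ∀ E : Set (X × X), MeasurableSet E → Prod.map T T ⁻¹' E = E →
      ∫ z in E, (starRingEnd ℂ) (f₁ z.1) * f₁ z.2 ∂(μ.prod μ) = 0 := by
    intro E hE hEinv
    rw [← setIntegral_invariant_eq_zero hT.toMeasurePreserving hTinv hfK hE hEinv]
    have h1 := ((hf.mono_exponent (p := 2) le_top).coeFn_toLp).trans hff₁
    refine integral_congr_ae (ae_restrict_of_ae ?_)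
    filter_upwards [Measure.quasiMeasurePreserving_fst.ae h1,
      Measure.quasiMeasurePreserving_snd.ae h1] with z hz1 hz2
    rw [hz1, hz2]
  -- The averages start at n = 1, so small correlations are required from T x on, and likewise
  -- convergence is used at S y.
  have hgood : ∀ᵐ x ∂μ, (∀ n : ℕ, f (T^[n] x) = f₁ (T^[n] x)) ∧
      HasSmallCorrelations fun n => f₁ (T^[n] (T x)) :=
    (ae_all_iff.2 fun n => (hT.toMeasurePreserving.iterate n).quasiMeasurePreserving.ae hff₁).and
      (hT.quasiMeasurePreserving.ae (ae_hasSmallCorrelations hT hf₁ hfin hC' hinv))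
  obtain ⟨Z, hsub, hZ, hZ0⟩ := exists_measurable_superset_of_null (ae_iff.1 hgood)
  refine ⟨Zᶜ, hZ.compl, (prob_compl_eq_one_iff hZ).2 hZ0, ?_⟩
  intro Y _ ν _ S hS _ g hg x hx
  obtain ⟨hx1, hx2⟩ := not_not.1 fun h => hx (hsub h)
  filter_upwards [hS.quasiMeasurePreserving.ae
    (ae_tendsto_average hS.toMeasurePreserving hg (fun k => hC' (T^[k] (T x))) hx2)] with y hy
  refine hy.congr fun N => ?_
  congr 1
  rw [← Finset.Ico_add_one_right_eq_Icc, Finset.sum_Ico_eq_sum_range, Nat.add_sub_cancel]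
  refine Finset.sum_congr rfl fun k _ => ?_
  rw [hx1, add_comm 1 k, Function.iterate_succ_apply, Function.iterate_succ_apply]
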